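/- Let $q\ge 1$ be an integer, let $\chi$ be an even primitive Dirichlet character modulo $q$ (for $q=1$, the trivial character), let $N$ be an odd positive integer and let $x>0$ be real. Then all the infinite series below converge absolutely, and $$\sum_{r=1}^{q}\sum_{n=1}^{\infty}\frac{\chi(r)}{n}\,\frac{\exp\left(-\frac{r}{q}n^N x\right)}{1-\exp(-n^N x)}=\mathcal R_0+\mathcal R_1+\mathcal R(N)+\mathcal K_{\chi,N}(x),$$ where $$\mathcal R_0=\begin{cases}\dfrac{1}{2N}\left(\gamma(1-N)-\log(2\pi)+\log x\right), & q=1,\\[2mm] -\dfrac{1}{2N}\displaystyle\sum_{r=1}^{q-1}\chi(r)\log\left(\sin\left(\frac{r\pi}{q}\right)\right), & q>1,\end{cases}$$ $$\mathcal R_1=\begin{cases}\dfrac{\zeta(N+1)}{x}, & q=1,\\ 0, & q>1,\end{cases}\qquad \mathcal R(N)=\begin{cases}\dfrac{x}{2q}L(-1,\chi), & N=1,\\ 0, & N>1,\end{cases}$$ and $$\mathcal K_{\chi,N}(x)=(-1)^{\frac{N+3}{2}}\frac{\mathcal G(\chi)}{N}\sum_{n=1}^{\infty}\frac{\overline{\chi}(n)}{n}\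 \sum_{j}\frac{\exp\left(\frac{i\pi j}{2}\right)}{\exp\left(2\pi\left(\frac{2\pi n}{x}\right)^{1/N}\exp\left(-\frac{i\pi j}{2N}\right)\right)-1},$$ the inner sum being over $j=-(N-1),-(N-3),\dots,N-3,N-1$. Here $\gamma$ is Euler's constant, $\zeta$ is the Riemann zeta function, $L(s,\chi)$ is the analytically continued Dirichlet $L$-function of $\chi$, $\overline{\chi}$ is the complex conjugate character, and $\mathcal G(\chi)=\sum_{r=1}^{q}\chi(r)e^{2\pi i r/q}$ is the Gauss sum. -/

import Mathlib

noncomputable section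

namespace LambertChar

/-- The double-primed sum `∑''_{j = -(N-1)}^{N-1} f j`, in which `j` runs through
`-(N-1), -(N-3), …, N-3, N-1`, that is, `j = 2k - (N-1)` for `0 ≤ k < N`. -/
def doublePrimeSum (N : ℕ) (f : ℤ → ℂ) : ℂ :=
  ∑ k ∈ Finset.range N, f (2 * (k : ℤ) - ((N : ℤ) - 1))

/-- The term `(χ(r) / n) * exp(-(r/q) n^N x) / (1 - exp(-n^N x))` of the Lambert series. -/
def lambertTerm {q : ℕ} (χ : DirichletCharacter ℂ q) (N : ℕ) (x : ℝ) (r n : ℕ) : ℂ :=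
  χ (r : ZMod q) / (n : ℂ) *
    ((Real.exp (-((r : ℝ) / (q : ℝ)) * (n : ℝ) ^ N * x) /
      (1 - Real.exp (-(n : ℝ) ^ N * x)) : ℝ) : ℂ)

/-- The contribution of the residue at `0` (for an even primitive character). -/
def R0 {q : ℕ} (χ : DirichletCharacter ℂ q) (N : ℕ) (x : ℝ) : ℂ :=
  if q = 1 then
    ((1 / (2 * (N : ℝ)) * (Real.eulerMascheroniConstant * (1 - (N : ℝ))
      - Real.log (2 * Real.pi) + Real.log x) : ℝ) : ℂ)
  else
    -(1 / (2 * (N : ℂ))) * ∑ r ∈ Finset.Icc 1 (q - 1),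
      χ (r : ZMod q) * (Real.log (Real.sin ((r : ℝ) * Real.pi / (q : ℝ))) : ℂ)

/-- The term `ζ(N+1)/x`, present only for `q = 1`. -/
def R1 (q N : ℕ) (x : ℝ) : ℂ :=
  if q = 1 then riemannZeta ((N : ℂ) + 1) / (x : ℂ) else 0

/-- The term `(x / 2q) L(-1, χ)`, present only for `N = 1`; `L(s, χ)` is the analytically
continued Dirichlet `L`-function. -/
def RN {q : ℕ} [NeZero q] (χ : DirichletCharacter ℂ q) (N : ℕ) (x : ℝ) : ℂ :=
  if N = 1 then (x : ℂ) / (2 * (q : ℂ)) * DirichletCharacter.LFunction χ (-1) else 0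

/-- The Gauss sum `∑_{r=1}^{q} χ(r) exp(2πir/q)`. -/
def gauss {q : ℕ} (χ : DirichletCharacter ℂ q) : ℂ :=
  ∑ r ∈ Finset.Icc 1 q, χ (r : ZMod q) *
    Complex.exp (2 * (Real.pi : ℂ) * Complex.I * (r : ℂ) / (q : ℂ))

/-- The `n`-th term of the dual series: `conj(χ(n)) / n` times the double-primed sum over `j` of
`exp(iπj/2) / (exp(2π (2πn/x)^(1/N) exp(-iπj/(2N))) - 1)`. -/
def dualTerm {q : ℕ} (χ : DirichletCharacter ℂ q) (N : ℕ) (x : ℝ) (n : ℕ) : ℂ :=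
  (starRingEnd ℂ) (χ (n : ZMod q)) / (n : ℂ) *
    doublePrimeSum N fun j : ℤ =>
      Complex.exp (Complex.I * (Real.pi : ℂ) * (j : ℂ) / 2) /
        (Complex.exp (2 * (Real.pi : ℂ) *
            (((2 * Real.pi * (n : ℝ) / x) ^ (1 / (N : ℝ)) : ℝ) : ℂ) *
            Complex.exp (-(Complex.I * (Real.pi : ℂ) * (j : ℂ)) / (2 * (N : ℂ)))) - 1)

/-- The dual series `K_{χ,N}(x)`, meant for odd `N` (then `N + 3` is even). -/
def K {q : ℕ} (χ : DirichletCharacter ℂ q) (N : ℕ) (x : ℝ) : ℂ :=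
  (-1) ^ ((N + 3) / 2) * (gauss χ / (N : ℂ)) * ∑' n : ℕ+, dualTerm χ N x (n : ℕ)

end LambertChar

end

/-! Put y = n^N x. For q > 1, evenness and primitivity of χ give the sum over r of χ(r) e^(-ry/q) /
(1 - e^(-y)) the partial fraction expansion ∑_m τ(m) 2y / (y² + 4π²m²), where τ(m) = ∑_r χ(r)
e^(2πirm/q) equals G(χ) times the conjugate of χ(m) (`hasSum_twistedSum_mul_poissonTerm`,
`twistedSum_eq_gauss_mul`). Divide by n, sum over n and interchange. For fixed m the sum over n is
elementary (`hasSum_pow_div_pow_add_sq`): partial fractions in n² reduce it to the expansion of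
coth. It splits into 1/(2Nm), the inner sum of the dual series over m, and, for N = 1, a multiple of
1/m². Against τ(m) these give R0, K and R(N), the last by the functional equation
(`LFunction_neg_one_eq_tsum`).

The double series is not absolutely convergent. `tendsto_sum_mul_tsum_poissonTerm` therefore
truncates the sum over m and uses dominated convergence in n, for which the truncated sums must be
O(1/y) uniformly in the cutoff M. For q > 1 this is Abel summation with the bounded partial sums of
τ. Convergence of ∑ τ(m)/m is then a by-product, and Abel's limit theorem evaluates it through log(1
- e^(2πir/q)).

For q = 1, τ = 1 and ∑ 1/m diverges. Subtracting the integral of the kernel, (1/π) arctan(2πM/y),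
restores the bound. Weighted by 1/n and summed over n, these corrections grow like log M / (2N);
`tendsto_tsum_arctan_div_pow` gives them up to o(1), and their difference from the harmonic sum
leaves the constant R0. The term -1/y in the expansion of 1/(e^y - 1) produces ζ(N+1)/x. -/

/-! ### Closed form of the sum over n -/

open Complex in
/-- Mittag-Leffler expansion of the hyperbolic cotangent in the right half-plane. -/
theorem hasSum_one_div_sq_add_sq {a : ℂ} (ha : 0 < a.re) :
    HasSum (fun n : ℕ => 1 / (((n : ℂ) + 1) ^ 2 + a ^ 2))
      (Real.pi / (2 * a) * (1 + 2 / (exp (2 * Real.pi * a) - 1)) - 1 / (2 * a ^ 2)) := by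
  have ha0 : a ≠ 0 := by rintro rfl; simp at ha
  have him : 0 < (a * I).im := by simpa using ha
  have hmem : a * I ∈ integerComplement :=
    UpperHalfPlane.coe_mem_integerComplement ⟨a * I, him⟩
  have hne : ∀ n : ℕ, ((n : ℂ) + 1) ^ 2 + a ^ 2 ≠ 0 := by
    intro n h
    have h2 := integerComplement_pow_two_ne_pow_two hmem ((n : ℤ) + 1)
    apply h2
    push_cast
    rw [mul_pow, I_sq]
    linear_combination -h
  have h1 := (summable_cotTerm hmem).hasSum
  have h2 := cot_series_rep' hmem
  rw [show (∑' n, cotTerm (a * I) n) = _ from h2.symm, cot_pi_eq_exp_ratio] at h1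
  -- A cotangent term at aI is -2aI / ((n+1)² + a²); this factor normalises it.
  have h3 := h1.mul_left (-1 / (2 * a * I))
  have hE : exp (2 * Real.pi * a) ≠ 1 := by
    intro h
    have := congrArg norm h
    rw [norm_exp, norm_one, Real.exp_eq_one_iff] at this
    have hpi := Real.pi_pos
    have h' : 2 * Real.pi * a.re = 0 := by simpa using this
    have : 0 < 2 * Real.pi * a.re := by positivity
    exact this.ne' h'
  convert! h3 using 1
  · ext n
    rw [cotTerm_identity hmem]
    have h4 : (a * I + (n + 1)) * (a * I - (n + 1)) = -(((n : ℂ) + 1) ^ 2 + a ^ 2) := by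
      ring_nf; rw [I_sq]; ring
    rw [h4]
    have := hne n
    field_simp
  · have h5 : exp (2 * Real.pi * I * (a * I)) = (exp (2 * Real.pi * a))⁻¹ := by
      rw [← exp_neg]; congr 1; ring_nf; rw [I_sq]; ring
    rw [h5]
    have h6 : exp (2 * Real.pi * a) - 1 ≠ 0 := sub_ne_zero.mpr hE
    have h7 := exp_ne_zero (2 * Real.pi * a)
    generalize exp (2 * Real.pi * a) = E at *
    have h8 : (1 - E⁻¹) ≠ 0 := by
      rw [sub_ne_zero]; intro h; apply hE; rw [eq_comm, inv_eq_one] at h; exact h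
    have h9 : 1 - E⁻¹ = (E - 1) / E := by field_simp
    rw [h9]
    field_simp
    ring_nf
    simp only [I_sq]
    ring

/-- Partial fractions of `v ^ h / (v ^ N + D)` for `N = 2 * h + 1`, where the poles are the
negatives of the `N`-th roots `b * ω ^ k` of `D`. -/
theorem sum_div_add_root {N h : ℕ} (hN : N = 2 * h + 1) {ω b D v : ℂ}
    (hω : IsPrimitiveRoot ω N) (hb : b ^ N = D) (hb0 : b ≠ 0) (hv : v ^ N + D ≠ 0) :
    ∑ k ∈ Finset.range N, ((b * ω ^ k) ^ h)⁻¹ / (v + b * ω ^ k) =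
      (-1) ^ h * N * v ^ h / (v ^ N + D) := by
  have hω0 : ω ≠ 0 := hω.ne_zero (by omega)
  have hodd : Odd N := ⟨h, hN⟩
  have hterm : ∀ k ∈ Finset.range N, ((b * ω ^ k) ^ h)⁻¹ / (v + b * ω ^ k) =
      (∑ i ∈ Finset.range N, v ^ i * (-b) ^ (N - 1 - i) * (b ^ h)⁻¹ *
        (ω ^ (N - 1 - i) * (ω ^ h)⁻¹) ^ k) / (v ^ N + D) := by
    intro k _
    have hk : (b * ω ^ k) ^ N = D := by
      rw [mul_pow, hb, ← pow_mul, mul_comm k, pow_mul, hω.pow_eq_one, one_pow, mul_one]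
    -- As N is odd, (-bω^k)^N = -D, so v + bω^k divides v^N + D with a geometric-sum quotient.
    have hgeom := (Commute.all v (-(b * ω ^ k))).mul_geom_sum₂ N
    rw [hodd.neg_pow, hk, sub_neg_eq_add, sub_neg_eq_add] at hgeom
    have hne : v + b * ω ^ k ≠ 0 := by
      intro h0; rw [h0, zero_mul] at hgeom; exact hv hgeom.symm
    rw [div_eq_div_iff hne hv, ← hgeom, mul_comm (v + b * ω ^ k), ← mul_assoc, Finset.mul_sum]
    congr 1
    refine Finset.sum_congr rfl fun i _ => ?_
    rw [neg_mul_eq_neg_mul, mul_pow, mul_pow, mul_pow, mul_inv, inv_pow, ← pow_mul, ← pow_mul,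
      ← pow_mul, ← pow_mul, mul_comm k, mul_comm k]
    ring
  rw [Finset.sum_congr rfl hterm, ← Finset.sum_div, Finset.sum_comm]
  congr 1
  simp_rw [← Finset.mul_sum]
  -- The sum over k is a sum of powers of the root of unity ω^(h-i), which vanishes unless i = h.
  rw [Finset.sum_eq_single h]
  · have e : N - 1 - h = h := by omega
    rw [e, mul_inv_cancel₀ (pow_ne_zero _ hω0)]
    simp only [one_pow, Finset.sum_const, Finset.card_range, nsmul_eq_mul, mul_one]
    rw [neg_pow b]
    have := pow_ne_zero h hb0
    field_simp
  · intro i hi hne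
    have hi' := Finset.mem_range.mp hi
    have h1 : ω ^ (N - 1 - i) * (ω ^ h)⁻¹ ≠ 1 := by
      intro h1
      rw [mul_inv_eq_one₀ (pow_ne_zero _ hω0)] at h1
      have := hω.pow_inj (by omega) (by omega) h1
      omega
    have h2 : (ω ^ (N - 1 - i) * (ω ^ h)⁻¹) ^ N = 1 := by
      rw [mul_pow, inv_pow, ← pow_mul, ← pow_mul, mul_comm _ N, mul_comm _ N, pow_mul, pow_mul,
        hω.pow_eq_one]
      simp
    rw [geom_sum_eq h1, h2]
    simp
  · intro hh
    exact absurd (Finset.mem_range.mpr (by omega)) hh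

-- The angle is πj/(2N) up to sign with |j| < N, hence inside (-π/2, π/2). The coth expansion and
-- the bound on the dual series both rest on this.
open Complex in
theorem re_exp_doublePrimeSum_index_pos {N k : ℕ} (hk : k < N) :
    0 < (exp (-(I * Real.pi * ((2 * (k : ℤ) - ((N : ℤ) - 1) : ℤ) : ℂ)) / (2 * N))).re := by
  set j : ℤ := 2 * (k : ℤ) - ((N : ℤ) - 1) with hj
  have harg : -(I * Real.pi * (j : ℂ)) / (2 * N) =
      ((-(Real.pi * j) / (2 * N) : ℝ) : ℂ) * I := by
    push_cast; ring
  rw [harg, exp_ofReal_mul_I_re]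
  refine Real.cos_pos_of_mem_Ioo ?_
  have hNR : (0 : ℝ) < N := Nat.cast_pos.mpr (by omega)
  have hj1 : (j : ℝ) < N := by
    have : j < N := by omega
    exact_mod_cast this
  have hj2 : -(N : ℝ) < j := by
    have : -(N : ℤ) < j := by omega
    exact_mod_cast this
  have hpi := Real.pi_pos
  constructor
  · rw [lt_div_iff₀ (by positivity)]; nlinarith
  · rw [div_lt_iff₀ (by positivity)]; nlinarith

open Complex in
/-- Closed form of `∑ n ^ (N - 1) / (n ^ (2 N) + T ^ 2)` over `n ≥ 1`, for odd `N`. -/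
theorem hasSum_pow_div_pow_add_sq {N h : ℕ} (hN : N = 2 * h + 1) {T : ℝ} (hT : 0 < T) :
    HasSum (fun n : ℕ => ((n : ℂ) + 1) ^ (N - 1) / (((n : ℂ) + 1) ^ (2 * N) + (T : ℂ) ^ 2))
      (Real.pi / (2 * N * T) + (-1) ^ h * (Real.pi / (N * T)) *
        LambertChar.doublePrimeSum N (fun j : ℤ => exp (I * Real.pi * j / 2) /
          (exp (2 * Real.pi * ((T ^ (1 / (N : ℝ)) : ℝ) : ℂ) *
            exp (-(I * Real.pi * j) / (2 * N))) - 1)) -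
        if N = 1 then 1 / (2 * (T : ℂ) ^ 2) else 0) := by
  have hN0 : N ≠ 0 := by omega
  have hNC : (N : ℂ) ≠ 0 := Nat.cast_ne_zero.mpr hN0
  have hTC : (T : ℂ) ≠ 0 := ofReal_ne_zero.mpr hT.ne'
  set ρ : ℝ := T ^ (1 / (N : ℝ)) with hρ
  have hρ0 : 0 < ρ := Real.rpow_pos_of_pos hT _
  have hρC : (ρ : ℂ) ≠ 0 := ofReal_ne_zero.mpr hρ0.ne'
  have hρN : (ρ : ℂ) ^ N = T := by
    rw [← ofReal_pow, hρ, one_div, Real.rpow_inv_natCast_pow hT.le hN0]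
  have hNh : (N : ℂ) = 2 * h + 1 := by rw [hN]; push_cast; ring
  let J : ℕ → ℤ := fun k => 2 * (k : ℤ) - ((N : ℤ) - 1)
  have hJ : ∀ k, ((J k : ℤ) : ℂ) = 2 * (k : ℂ) - 2 * h := by
    intro k; simp only [J]; push_cast; rw [hNh]; ring
  let r : ℕ → ℂ := fun k => ρ * exp (-(I * Real.pi * (J k : ℤ)) / (2 * N))
  have hr0 : ∀ k, r k ≠ 0 := fun k => mul_ne_zero hρC (exp_ne_zero _)
  let ω : ℂ := (exp (2 * Real.pi * I / N))⁻¹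
  have hω : IsPrimitiveRoot ω N := (isPrimitiveRoot_exp N hN0).inv
  -- b is the square of r 0, where j = -2h; raising k by one multiplies the square by e^(-2πi/N),
  -- which is why ω is an inverse.
  let b : ℂ := ρ ^ 2 * exp (2 * h * Real.pi * I / N)
  have hb0 : b ≠ 0 := mul_ne_zero (pow_ne_zero _ hρC) (exp_ne_zero _)
  have hbN : b ^ N = (T : ℂ) ^ 2 := by
    simp only [b]
    rw [mul_pow, ← pow_mul, mul_comm 2 N, pow_mul, hρN, ← exp_nat_mul,
      show (N : ℂ) * (2 * h * Real.pi * I / N) = (h : ℂ) * (2 * Real.pi * I) by field_simp,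
      exp_nat_mul_two_pi_mul_I, mul_one]
  have hr2 : ∀ k, r k ^ 2 = b * ω ^ k := by
    intro k
    simp only [r, b, ω]
    rw [mul_pow, ← exp_nat_mul, ← exp_neg, ← exp_nat_mul, mul_assoc ((ρ : ℂ) ^ 2), ← exp_add, hJ]
    congr 2
    push_cast
    field_simp
    ring
  have hrN : ∀ k, r k ^ N * exp (I * Real.pi * (J k : ℤ) / 2) = T := by
    intro k
    simp only [r]
    rw [mul_pow, hρN, ← exp_nat_mul, mul_assoc, ← exp_add]
    have : (N : ℂ) * (-(I * Real.pi * (J k : ℤ)) / (2 * N)) + I * Real.pi * (J k : ℤ) / 2 = 0 := by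
      field_simp; ring
    rw [this, exp_zero, mul_one]
  have hrre : ∀ k ∈ Finset.range N, 0 < (r k).re := by
    intro k hk
    simp only [r]
    rw [re_ofReal_mul]
    exact mul_pos hρ0 (re_exp_doublePrimeSum_index_pos (Finset.mem_range.mp hk))
  have hpf : ∀ v : ℂ, v ^ N + (T : ℂ) ^ 2 ≠ 0 → v ^ h / (v ^ N + (T : ℂ) ^ 2) =
      (-1) ^ h / N * ∑ k ∈ Finset.range N, ((r k ^ 2) ^ h)⁻¹ * (1 / (v + r k ^ 2)) := by
    intro v hv
    have h1 := sum_div_add_root hN hω hbN hb0 hv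
    simp_rw [← hr2] at h1
    simp_rw [mul_one_div]
    rw [h1]
    have h2 : ((-1 : ℂ) ^ h) * (-1) ^ h = 1 := by rw [← mul_pow]; simp
    field_simp
    rw [sq, h2, mul_one]
  have hsum := (hasSum_sum fun k hk => (hasSum_one_div_sq_add_sq (hrre k hk)).mul_left
    ((r k ^ 2) ^ h)⁻¹).mul_left ((-1) ^ h / (N : ℂ))
  convert! hsum using 1
  · ext n
    rw [← hpf]
    · rw [← pow_mul, ← pow_mul]; congr 2; omega
    · have : ((((n : ℝ) + 1) ^ 2) ^ N + T ^ 2 : ℝ) ≠ 0 := by positivity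
      exact_mod_cast this
  · have hv0 : (0 : ℂ) ^ N + (T : ℂ) ^ 2 ≠ 0 := by
      rw [zero_pow hN0, zero_add]; exact pow_ne_zero _ hTC
    have h0 := hpf 0 hv0
    -- The terms -1/(2a²) of the coth expansion add up to the partial fraction identity at v = 0,
    -- where v^h survives only for h = 0.
    have hite : (if N = 1 then 1 / (2 * (T : ℂ) ^ 2) else 0) =
        1 / 2 * ((0 : ℂ) ^ h / (0 ^ N + (T : ℂ) ^ 2)) := by
      rw [zero_pow hN0, zero_add]
      by_cases hh : h = 0
      · rw [if_pos (by omega), hh, pow_zero]; field_simp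
      · rw [if_neg (by omega), zero_pow hh]; simp
    rw [hite, h0]
    -- This alternating sum collects the constant 1 in 1 + 2/(E - 1) into the term π/(2NT).
    have halt : ∑ k ∈ Finset.range N, exp (I * Real.pi * (J k : ℤ) / 2) = (-1) ^ h := by
      have h1 : ∀ k ∈ Finset.range N, exp (I * Real.pi * (J k : ℤ) / 2) =
          (-1) ^ k * (-1) ^ h := by
        intro k _
        rw [hJ, show I * (Real.pi : ℂ) * (2 * k - 2 * h) / 2 =
          k * (Real.pi * I) - h * (Real.pi * I) by ring, exp_sub, exp_nat_mul, exp_nat_mul,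
          exp_pi_mul_I]
        rw [div_eq_mul_inv, ← inv_pow]; norm_num
      rw [Finset.sum_congr rfl h1, ← Finset.sum_mul, hN, geom_sum_eq (by norm_num),
        Odd.neg_one_pow ⟨h, rfl⟩]
      norm_num
    have hsq : ((-1 : ℂ) ^ h) * (-1) ^ h = 1 := by rw [← mul_pow]; simp
    have hpi : (Real.pi : ℂ) / (2 * N * T) = (-1) ^ h * (Real.pi / (2 * N * T)) *
        ∑ k ∈ Finset.range N, exp (I * Real.pi * (J k : ℤ) / 2) := by
      rw [halt]; linear_combination (-(Real.pi : ℂ) / (2 * N * T)) * hsq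
    rw [hpi, LambertChar.doublePrimeSum]
    change _ * ∑ k ∈ Finset.range N, exp (I * Real.pi * (J k : ℤ) / 2) +
      _ * (∑ k ∈ Finset.range N, exp (I * Real.pi * (J k : ℤ) / 2) / (exp (2 * Real.pi * ρ *
            exp (-(I * Real.pi * (J k : ℤ)) / (2 * N))) - 1)) - _ = _
    simp_rw [Finset.mul_sum]
    rw [← Finset.sum_add_distrib, ← Finset.sum_sub_distrib]
    refine Finset.sum_congr rfl fun k hk => ?_
    rw [mul_assoc (2 * (Real.pi : ℂ)) ρ _]
    change _ + _ * (_ / (exp (2 * Real.pi * r k) - 1)) - _ = _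
    generalize exp (2 * Real.pi * r k) - 1 = E
    have hr := hr0 k
    have h3 : exp (I * Real.pi * (J k : ℤ) / 2) = T * ((r k ^ 2) ^ h)⁻¹ * (r k)⁻¹ := by
      rw [← hrN k, hN, pow_succ, pow_mul]; field_simp
    rw [h3, zero_add]
    field_simp

/-! ### Fourier series of the hyperbolic cosine -/

-- Both exponentials integrate explicitly, and e^(-2πin) = 1 makes the common factor 1 - e^(-y)
-- appear.
open Complex in
theorem integral_exp_mul_fourier_factor (y : ℝ) (hy : y ≠ 0) (n : ℤ) :
    ∫ t in (0 : ℝ)..1, exp (-2 * Real.pi * I * n * t) * ((Real.exp (-t * y) +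
      Real.exp (-(1 - t) * y) : ℝ) : ℂ) =
      (1 - Real.exp (-y)) * (2 * y / (y ^ 2 + 4 * Real.pi ^ 2 * (n : ℂ) ^ 2)) := by
  have hc1 : (-2 * Real.pi * I * n - y : ℂ) ≠ 0 := by
    intro h
    have := congrArg re h
    simp at this
    exact hy this
  have hc2 : (-2 * Real.pi * I * n + y : ℂ) ≠ 0 := by
    intro h
    have := congrArg re h
    simp at this
    exact hy this
  have hprod : (y : ℂ) ^ 2 + 4 * Real.pi ^ 2 * (n : ℂ) ^ 2 =
      -((-2 * Real.pi * I * n - y) * (-2 * Real.pi * I * n + y)) := by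
    ring_nf; rw [I_sq]; ring
  have hE : exp (-2 * Real.pi * I * n) = 1 := by
    rw [show (-2 * Real.pi * I * n : ℂ) = ((-n : ℤ) : ℂ) * (2 * Real.pi * I) by push_cast; ring]
    exact exp_int_mul_two_pi_mul_I _
  have hfun : ∀ t : ℝ, exp (-2 * Real.pi * I * n * t) * ((Real.exp (-t * y) +
      Real.exp (-(1 - t) * y) : ℝ) : ℂ) = exp ((-2 * Real.pi * I * n - y) * t) +
      exp (-y) * exp ((-2 * Real.pi * I * n + y) * t) := by
    intro t
    push_cast
    rw [mul_add, ← exp_add, ← exp_add, ← exp_add]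
    congr 2 <;> ring
  simp_rw [hfun]
  rw [intervalIntegral.integral_add
    (Continuous.intervalIntegrable (by fun_prop) _ _)
    (Continuous.intervalIntegrable (by fun_prop) _ _),
    intervalIntegral.integral_const_mul, integral_exp_mul_complex hc1,
    integral_exp_mul_complex hc2, hprod]
  simp only [ofReal_one, mul_one, ofReal_zero, mul_zero, exp_zero]
  rw [exp_sub, exp_add, hE, ofReal_exp, ofReal_neg, exp_neg]
  have hd : (2 * y : ℂ) = (-2 * Real.pi * I * n + y) - (-2 * Real.pi * I * n - y) := by ring
  rw [hd]
  generalize (-2 * Real.pi * I * n - y : ℂ) = p at *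
  generalize (-2 * Real.pi * I * n + y : ℂ) = r at *
  have := exp_ne_zero (y : ℂ)
  field_simp
  ring

open Complex in
/-- Fourier expansion of the even `1`-periodic extension of a hyperbolic cosine. -/
theorem hasSum_cos_div_sq_add_sq {y : ℝ} (hy : 0 < y) {a : ℝ} (ha : a ∈ Set.Icc (0 : ℝ) 1) :
    HasSum (fun n : ℕ => 4 * y / (y ^ 2 + 4 * Real.pi ^ 2 * ((n : ℝ) + 1) ^ 2) *
      Real.cos (2 * Real.pi * ((n : ℝ) + 1) * a))
      ((Real.exp (-a * y) + Real.exp (-(1 - a) * y)) / (1 - Real.exp (-y)) - 2 / y) := by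
  have : Fact ((0 : ℝ) < 1) := ⟨zero_lt_one⟩
  let g : ℝ → ℂ := fun t => ((Real.exp (-t * y) + Real.exp (-(1 - t) * y) : ℝ) : ℂ)
  have hgc : Continuous g := by fun_prop
  have hg01 : g 0 = g 1 := by simp [g, add_comm]
  let G : C(AddCircle (1 : ℝ), ℂ) :=
    ⟨AddCircle.liftIco 1 0 g, AddCircle.liftIco_zero_continuous hg01 hgc.continuousOn⟩
  have hE0 : (1 - Real.exp (-y)) ≠ 0 := by
    have : Real.exp (-y) < 1 := Real.exp_lt_one_iff.mpr (by linarith)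
    linarith
  have hcoef : ∀ n : ℤ, fourierCoeff G n =
      (1 - Real.exp (-y)) * (2 * y / (y ^ 2 + 4 * Real.pi ^ 2 * (n : ℂ) ^ 2)) := by
    intro n
    change fourierCoeff (AddCircle.liftIco 1 0 g) n = _
    rw [fourierCoeff_liftIco_eq, fourierCoeffOn_eq_integral,
      ← integral_exp_mul_fourier_factor y hy.ne' n]
    simp only [zero_add, sub_zero, div_one, one_smul, fourier_coe_apply, smul_eq_mul, g]
    refine intervalIntegral.integral_congr fun t _ => ?_
    simp only [ofReal_one, div_one]
    congr 2
    push_cast; ring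
  have hsummN : Summable fun n : ℕ => 2 * y / (y ^ 2 + 4 * Real.pi ^ 2 * ((n : ℝ)) ^ 2) := by
    have h1 : Summable fun n : ℕ => 2 * y * (1 / (n : ℝ) ^ 2) :=
      (Real.summable_one_div_nat_pow.mpr one_lt_two).mul_left _
    refine Summable.of_norm_bounded_eventually_nat h1 ?_
    filter_upwards [Filter.eventually_gt_atTop 0] with n hn
    have hn' : (0 : ℝ) < n := Nat.cast_pos.mpr hn
    rw [Real.norm_of_nonneg (by positivity), mul_one_div]
    have hpi : 1 ≤ 4 * Real.pi ^ 2 := by nlinarith [Real.pi_gt_three]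
    gcongr
    nlinarith [sq_nonneg y, sq_nonneg (n : ℝ)]
  have hsumm : Summable fun n : ℤ =>
      (1 - Real.exp (-y) : ℂ) * (2 * y / (y ^ 2 + 4 * Real.pi ^ 2 * (n : ℂ) ^ 2)) := by
    refine Summable.mul_left _ ?_
    have h1 : Summable fun n : ℕ =>
        ((2 * y / (y ^ 2 + 4 * Real.pi ^ 2 * ((n : ℝ)) ^ 2) : ℝ) : ℂ) :=
      Complex.summable_ofReal.mpr hsummN
    refine Summable.of_nat_of_neg ?_ ?_
    · refine h1.congr fun n => ?_
      push_cast; rfl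
    · refine h1.congr fun n => ?_
      push_cast; rw [neg_sq]
  have hF : ∀ z ∈ Set.Ico (0 : ℝ) 1, HasSum (fun n : ℕ =>
      4 * y / (y ^ 2 + 4 * Real.pi ^ 2 * ((n : ℝ) + 1) ^ 2) *
      Real.cos (2 * Real.pi * ((n : ℝ) + 1) * z))
      ((Real.exp (-z * y) + Real.exp (-(1 - z) * y)) / (1 - Real.exp (-y)) - 2 / y) := by
    intro z hz
    have h1 := has_pointwise_sum_fourier_series_of_summable
      (hsumm.congr fun n => (hcoef n).symm) (z : AddCircle (1 : ℝ))
    have hGz : G (z : AddCircle (1 : ℝ)) = g z := by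
      change AddCircle.liftIco 1 0 g (z : AddCircle (1 : ℝ)) = _
      exact AddCircle.liftIco_coe_apply (show z ∈ Set.Ico (0 : ℝ) (0 + 1) by rwa [zero_add])
    rw [hGz] at h1
    simp_rw [hcoef] at h1
    -- Pairing n with -n counts the zero mode twice; removing index 0 leaves the total minus one
    -- zero mode, the source of -2/y.
    have h2 := h1.nat_add_neg
    have h3 := (hasSum_nat_add_iff' 1).mpr h2
    have h4 := h3.div_const (1 - Real.exp (-y) : ℂ)
    have hE0' : (1 - Real.exp (-y) : ℂ) ≠ 0 := by exact_mod_cast hE0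
    rw [← hasSum_ofReal]
    convert! h4 using 1
    · ext n
      simp only [fourier_coe_apply, smul_eq_mul]
      have hcos : ((Real.cos (2 * Real.pi * ((n : ℝ) + 1) * z) : ℝ) : ℂ) =
          (exp (2 * Real.pi * I * ((n : ℂ) + 1) * z) +
            exp (2 * Real.pi * I * (-((n : ℂ) + 1)) * z)) / 2 := by
        rw [ofReal_cos, Complex.cos]; push_cast
        congr 3 <;> ring
      push_cast at hcos hE0' ⊢
      rw [hcos, neg_sq, div_one, div_one, ← mul_add, mul_assoc (1 - exp (-(y : ℂ))),
        mul_div_cancel_left₀ _ hE0']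
      ring
    · simp only [Finset.range_one, Finset.sum_singleton, g]
      have hyC : (y : ℂ) ≠ 0 := ofReal_ne_zero.mpr hy.ne'
      push_cast at hE0' ⊢
      simp
      field_simp
  -- The lift to the circle is read on [0, 1), so the endpoint 1 is transferred to 0 by periodicity.
  rcases eq_or_lt_of_le ha.2 with rfl | h1
  · have := hF 0 ⟨le_rfl, zero_lt_one⟩
    convert! this using 1
    · ext n
      rw [mul_zero, Real.cos_zero]
      have : Real.cos (2 * Real.pi * ((n : ℝ) + 1) * 1) = 1 := by
        rw [show 2 * Real.pi * ((n : ℝ) + 1) * 1 = ((n + 1 : ℕ) : ℝ) * (2 * Real.pi) by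
          push_cast; ring]
        exact Real.cos_nat_mul_two_pi _
      rw [this]
    · simp [add_comm]
  · exact hF a ⟨ha.1, h1⟩

/-! ### Asymptotics of the arctangent series -/

/-- The function `w ↦ arctan (exp (-N w))`. -/
noncomputable def arctanExp (N : ℕ) (w : ℝ) : ℝ := Real.arctan (Real.exp (-(N * w)))

theorem continuous_arctanExp (N : ℕ) : Continuous (arctanExp N) := by
  unfold arctanExp
  exact Real.continuous_arctan.comp (by fun_prop)

theorem arctanExp_nonneg (N : ℕ) (w : ℝ) : 0 ≤ arctanExp N w :=
  Real.arctan_nonneg.mpr (Real.exp_pos _).le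

theorem arctanExp_le_pi_div_two (N : ℕ) (w : ℝ) : arctanExp N w ≤ Real.pi / 2 :=
  (Real.arctan_lt_pi_div_two _).le

theorem arctan_le_self {u : ℝ} (hu : 0 ≤ u) : Real.arctan u ≤ u := by
  rcases hu.eq_or_lt with rfl | hu
  · simp
  have h := Real.lt_tan (Real.arctan_pos.mpr hu) (Real.arctan_lt_pi_div_two u)
  rw [Real.tan_arctan] at h
  exact h.le

theorem arctanExp_le_exp (N : ℕ) (w : ℝ) : arctanExp N w ≤ Real.exp (-(N * w)) :=
  arctan_le_self (Real.exp_pos _).le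

theorem antitone_arctanExp (N : ℕ) : Antitone (arctanExp N) := by
  intro a b hab
  refine Real.arctan_mono (Real.exp_le_exp.mpr ?_)
  gcongr

/-- From arctan u + arctan(1/u) = π/2; behaviour at -∞ reduces to that at +∞. -/
theorem arctanExp_neg (N : ℕ) (w : ℝ) : arctanExp N (-w) = Real.pi / 2 - arctanExp N w := by
  unfold arctanExp
  rw [← Real.arctan_inv_of_pos (Real.exp_pos _), ← Real.exp_neg]
  ring_nf

/-- The derivative is -Nu/(1 + u²) with u = e^(-Nw), of modulus at most N. -/
theorem arctanExp_sub_le (N : ℕ) {a b : ℝ} (hab : a ≤ b) :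
    arctanExp N a - arctanExp N b ≤ N * (b - a) := by
  have hd : ∀ w, HasDerivAt (arctanExp N)
      (1 / (1 + Real.exp (-(N * w)) ^ 2) * (Real.exp (-(N * w)) * -(N * 1))) w := fun w =>
    (((hasDerivAt_id w).const_mul (N : ℝ)).neg.exp).arctan
  have h := Convex.norm_image_sub_le_of_norm_hasDerivWithin_le (C := N) (s := Set.univ)
    (fun w _ => (hd w).hasDerivWithinAt) (fun w _ => ?_) convex_univ (Set.mem_univ b)
    (Set.mem_univ a)
  · rw [Real.norm_eq_abs, Real.norm_eq_abs, abs_of_nonpos (by linarith : a - b ≤ 0)] at h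
    linarith [le_abs_self (arctanExp N a - arctanExp N b)]
  · have he := Real.exp_pos (-(N * w))
    rw [Real.norm_eq_abs, abs_mul, abs_mul, abs_neg, mul_one, Nat.abs_cast,
      abs_of_pos (by positivity), abs_of_pos he, ← mul_assoc]
    have : 1 / (1 + Real.exp (-(N * w)) ^ 2) * Real.exp (-(N * w)) ≤ 1 := by
      rw [one_div, ← div_eq_inv_mul, div_le_one (by positivity)]
      nlinarith [sq_nonneg (Real.exp (-(N * w)) - 1)]
    calc _ ≤ 1 * (N : ℝ) := by gcongr
      _ = N := one_mul _

/-- The primitive of `arctanExp` vanishing at `0`. -/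
noncomputable def arctanExpPrimitive (N : ℕ) (v : ℝ) : ℝ := ∫ w in (0 : ℝ)..v, arctanExp N w

theorem intervalIntegrable_arctanExp (N : ℕ) (a b : ℝ) :
    IntervalIntegrable (arctanExp N) MeasureTheory.volume a b :=
  (continuous_arctanExp N).intervalIntegrable a b

theorem arctanExpPrimitive_sub (N : ℕ) (a b : ℝ) :
    arctanExpPrimitive N b - arctanExpPrimitive N a = ∫ w in a..b, arctanExp N w :=
  intervalIntegral.integral_interval_sub_left (intervalIntegrable_arctanExp N _ _)
    (intervalIntegrable_arctanExp N _ _)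

theorem arctanExpPrimitive_sub_le (N : ℕ) {a b : ℝ} (hab : a ≤ b) :
    arctanExpPrimitive N b - arctanExpPrimitive N a ≤ (b - a) * arctanExp N a := by
  rw [arctanExpPrimitive_sub, ← smul_eq_mul, ← intervalIntegral.integral_const]
  exact intervalIntegral.integral_mono_on hab (intervalIntegrable_arctanExp N _ _)
    (by simp) fun w hw => antitone_arctanExp N hw.1

theorem le_arctanExpPrimitive_sub (N : ℕ) {a b : ℝ} (hab : a ≤ b) :
    (b - a) * arctanExp N b ≤ arctanExpPrimitive N b - arctanExpPrimitive N a := by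
  rw [arctanExpPrimitive_sub, ← smul_eq_mul, ← intervalIntegral.integral_const]
  exact intervalIntegral.integral_mono_on hab (by simp) (intervalIntegrable_arctanExp N _ _)
    fun w hw => antitone_arctanExp N hw.2

theorem monotone_arctanExpPrimitive (N : ℕ) : Monotone (arctanExpPrimitive N) := by
  intro a b hab
  have := le_arctanExpPrimitive_sub N hab
  have h := mul_nonneg (sub_nonneg.mpr hab) (arctanExp_nonneg N b)
  linarith

/-- Isolates the linear growth at -∞, which becomes the main term (π/2)L. -/
theorem arctanExpPrimitive_neg (N : ℕ) (v : ℝ) :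
    arctanExpPrimitive N (-v) = arctanExpPrimitive N v - Real.pi / 2 * v := by
  have h : ∫ w in (0 : ℝ)..v, arctanExp N (-w) = ∫ w in -v..0, arctanExp N w := by
    simp
  have h2 : ∫ w in (0 : ℝ)..v, arctanExp N (-w) = Real.pi / 2 * v - arctanExpPrimitive N v := by
    simp_rw [arctanExp_neg]
    rw [intervalIntegral.integral_sub (by simp) (intervalIntegrable_arctanExp N _ _)]
    rw [intervalIntegral.integral_const, sub_zero, smul_eq_mul, mul_comm, arctanExpPrimitive]
  rw [arctanExpPrimitive, intervalIntegral.integral_symm, ← h, h2]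
  ring

theorem exists_tendsto_arctanExpPrimitive {N : ℕ} (hN : 1 ≤ N) :
    ∃ l, Filter.Tendsto (arctanExpPrimitive N) Filter.atTop (nhds l) := by
  refine ⟨_, tendsto_atTop_ciSup (monotone_arctanExpPrimitive N) ⟨1, ?_⟩⟩
  rintro _ ⟨v, rfl⟩
  rcases le_total v 0 with hv | hv
  · refine (monotone_arctanExpPrimitive N hv).trans ?_
    simp [arctanExpPrimitive]
  · have h1 : arctanExpPrimitive N v ≤ ∫ w in (0 : ℝ)..v, Real.exp (-w) := by
      refine intervalIntegral.integral_mono_on hv (intervalIntegrable_arctanExp N _ _)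
        (Continuous.intervalIntegrable (by fun_prop) _ _) fun w hw => ?_
      refine (arctanExp_le_exp N w).trans (Real.exp_le_exp.mpr ?_)
      have : (1 : ℝ) ≤ N := by exact_mod_cast hN
      nlinarith [hw.1]
    refine h1.trans ?_
    rw [intervalIntegral.integral_comp_neg (fun w => Real.exp w), integral_exp]
    simp [Real.exp_nonneg]

theorem summable_one_div_succ_sq : Summable fun n : ℕ => 1 / ((n : ℝ) + 1) ^ 2 := by
  have := (summable_nat_add_iff 1).mpr (Real.summable_one_div_nat_pow.mpr one_lt_two)
  exact_mod_cast this

theorem log_succ_sub_log_le (n : ℕ) :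
    Real.log ((n : ℝ) + 2) - Real.log ((n : ℝ) + 1) ≤ 1 / ((n : ℝ) + 1) := by
  rw [← Real.log_div (by positivity) (by positivity)]
  refine (Real.log_le_sub_one_of_pos (by positivity)).trans (le_of_eq ?_)
  field_simp
  ring

theorem le_log_succ_sub_log (n : ℕ) :
    1 / ((n : ℝ) + 2) ≤ Real.log ((n : ℝ) + 2) - Real.log ((n : ℝ) + 1) := by
  have h := Real.log_le_sub_one_of_pos (show 0 < ((n : ℝ) + 1) / (n + 2) by positivity)
  rw [Real.log_div (by positivity) (by positivity)] at h
  have : ((n : ℝ) + 1) / (n + 2) - 1 = - (1 / (n + 2)) := by field_simp; ring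
  linarith

/-- The partial sums telescope to H_n - log(n+1). -/
theorem hasSum_eulerMascheroni :
    HasSum (fun n : ℕ => 1 / ((n : ℝ) + 1) - (Real.log ((n : ℝ) + 2) - Real.log ((n : ℝ) + 1)))
      Real.eulerMascheroniConstant := by
  rw [hasSum_iff_tendsto_nat_of_nonneg (fun n => sub_nonneg.mpr (log_succ_sub_log_le n))]
  refine Real.tendsto_eulerMascheroniSeq.congr fun n => ?_
  induction n with
  | zero => simp [Real.eulerMascheroniSeq_zero]
  | succ n ih =>
    rw [Finset.sum_range_succ, ← ih, Real.eulerMascheroniSeq, Real.eulerMascheroniSeq,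
      harmonic_succ]
    push_cast
    rw [show (n : ℝ) + 1 + 1 = n + 2 by ring, one_div]
    ring

/-- The defect between a term of `∑ arctanExp N (log n - L) / n` and the corresponding
integral. -/
noncomputable def arctanExpDefect (N : ℕ) (L : ℝ) (n : ℕ) : ℝ :=
  1 / ((n : ℝ) + 1) * arctanExp N (Real.log ((n : ℝ) + 1) - L) -
    (arctanExpPrimitive N (Real.log ((n : ℝ) + 2) - L) -
      arctanExpPrimitive N (Real.log ((n : ℝ) + 1) - L))

/-- With ℓ the logarithmic step, monotonicity bounds the defect by (1/(n+1) - ℓ)p + ℓ(p - p'). Each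
part is O(1/(n+1)²) uniformly in L, as p ≤ π/2 and `arctanExp` is N-Lipschitz. -/
theorem abs_arctanExpDefect_le (N : ℕ) (L : ℝ) (n : ℕ) :
    |arctanExpDefect N L n| ≤ (Real.pi / 2 + N) * (1 / ((n : ℝ) + 1) ^ 2) := by
  set ℓ := Real.log ((n : ℝ) + 2) - Real.log ((n : ℝ) + 1) with hℓ
  have hn : (0 : ℝ) < (n : ℝ) + 1 := by positivity
  have hℓ1 : ℓ ≤ 1 / ((n : ℝ) + 1) := log_succ_sub_log_le n
  have hℓ2 : 1 / ((n : ℝ) + 2) ≤ ℓ := le_log_succ_sub_log n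
  have hℓ0 : 0 ≤ ℓ := le_trans (by positivity) hℓ2
  have hab : Real.log ((n : ℝ) + 1) - L ≤ Real.log ((n : ℝ) + 2) - L := by linarith
  have hw : Real.log ((n : ℝ) + 2) - L - (Real.log ((n : ℝ) + 1) - L) = ℓ := by rw [hℓ]; ring
  have h1 := arctanExpPrimitive_sub_le N hab
  have h2 := le_arctanExpPrimitive_sub N hab
  have h3 := arctanExp_sub_le N hab
  rw [hw] at h1 h2 h3
  have h4 := arctanExp_nonneg N (Real.log ((n : ℝ) + 1) - L)
  have h5 := arctanExp_le_pi_div_two N (Real.log ((n : ℝ) + 1) - L)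
  unfold arctanExpDefect
  set p := arctanExp N (Real.log ((n : ℝ) + 1) - L)
  set p' := arctanExp N (Real.log ((n : ℝ) + 2) - L)
  set D := arctanExpPrimitive N (Real.log ((n : ℝ) + 2) - L) -
      arctanExpPrimitive N (Real.log ((n : ℝ) + 1) - L)
  have hdiff : 1 / ((n : ℝ) + 1) - ℓ ≤ 1 / ((n : ℝ) + 1) ^ 2 := by
    have : 1 / ((n : ℝ) + 1) - 1 / ((n : ℝ) + 2) ≤ 1 / ((n : ℝ) + 1) ^ 2 := by
      have e : 1 / ((n : ℝ) + 1) - 1 / ((n : ℝ) + 2) = 1 / (((n : ℝ) + 1) * (n + 2)) := by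
        field_simp; ring
      rw [e]
      gcongr
      nlinarith
    linarith
  have hℓsq : ℓ * ℓ ≤ 1 / ((n : ℝ) + 1) ^ 2 := by
    calc ℓ * ℓ ≤ 1 / ((n : ℝ) + 1) * (1 / ((n : ℝ) + 1)) := by gcongr
      _ = _ := by rw [sq]; field_simp
  have hlow : 0 ≤ 1 / ((n : ℝ) + 1) * p - D := by nlinarith
  rw [abs_of_nonneg hlow]
  calc 1 / ((n : ℝ) + 1) * p - D ≤ (1 / ((n : ℝ) + 1) - ℓ) * p + ℓ * (p - p') := by linarith
    _ ≤ 1 / ((n : ℝ) + 1) ^ 2 * (Real.pi / 2) + ℓ * (N * ℓ) := by gcongr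
    _ ≤ 1 / ((n : ℝ) + 1) ^ 2 * (Real.pi / 2) + N * (1 / ((n : ℝ) + 1) ^ 2) := by nlinarith
    _ = _ := by ring

open Filter Topology in
theorem tendsto_arctanExp_sub (N : ℕ) (hN : 1 ≤ N) (c : ℝ) :
    Tendsto (fun L => arctanExp N (c - L)) atTop (𝓝 (Real.pi / 2)) := by
  have hN' : (0 : ℝ) < N := by exact_mod_cast hN
  have h : Tendsto (fun L : ℝ => -(N * (c - L))) atTop atTop := by
    have : Tendsto (fun L : ℝ => N * L + -(N * c)) atTop atTop :=
      tendsto_atTop_add_const_right _ _ (tendsto_id.const_mul_atTop hN')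
    exact this.congr fun L => by ring
  exact (tendsto_nhds_of_tendsto_nhdsWithin Real.tendsto_arctan_atTop).comp
    (Real.tendsto_exp_atTop.comp h)

open Filter Topology in
theorem tendsto_arctanExpDefect (N : ℕ) (hN : 1 ≤ N) (n : ℕ) :
    Tendsto (fun L => arctanExpDefect N L n) atTop (𝓝 (Real.pi / 2 *
      (1 / ((n : ℝ) + 1) - (Real.log ((n : ℝ) + 2) - Real.log ((n : ℝ) + 1))))) := by
  set ℓ := Real.log ((n : ℝ) + 2) - Real.log ((n : ℝ) + 1) with hℓ
  have hℓ0 : 0 ≤ ℓ := le_trans (by positivity) (le_log_succ_sub_log n)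
  have h1 := tendsto_arctanExp_sub N hN (Real.log ((n : ℝ) + 1))
  have h2 := tendsto_arctanExp_sub N hN (Real.log ((n : ℝ) + 2))
  have hw : ∀ L, Real.log ((n : ℝ) + 2) - L - (Real.log ((n : ℝ) + 1) - L) = ℓ := by
    intro L; rw [hℓ]; ring
  have h3 : Tendsto (fun L => arctanExpPrimitive N (Real.log ((n : ℝ) + 2) - L) -
      arctanExpPrimitive N (Real.log ((n : ℝ) + 1) - L)) atTop (𝓝 (ℓ * (Real.pi / 2))) := by
    refine tendsto_of_tendsto_of_tendsto_of_le_of_le (h2.const_mul ℓ) (h1.const_mul ℓ) ?_ ?_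
    · intro L
      have := le_arctanExpPrimitive_sub N (a := Real.log ((n : ℝ) + 1) - L)
        (b := Real.log ((n : ℝ) + 2) - L) (by linarith [hw L])
      rwa [hw] at this
    · intro L
      have := arctanExpPrimitive_sub_le N (a := Real.log ((n : ℝ) + 1) - L)
        (b := Real.log ((n : ℝ) + 2) - L) (by linarith [hw L])
      rwa [hw] at this
  have := (h1.const_mul (1 / ((n : ℝ) + 1))).sub h3
  convert! this using 2
  ring

theorem arctan_exp_div_pow (N n : ℕ) (L : ℝ) :
    Real.arctan (Real.exp (N * L) / ((n : ℝ) + 1) ^ N) =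
      arctanExp N (Real.log ((n : ℝ) + 1) - L) := by
  unfold arctanExp
  congr 1
  rw [show -((N : ℝ) * (Real.log ((n : ℝ) + 1) - L)) = N * L - N * Real.log ((n : ℝ) + 1) by ring,
    Real.exp_sub, Real.exp_nat_mul (Real.log _), Real.exp_log (by positivity)]

theorem summable_arctan_div_pow {N : ℕ} (hN : 1 ≤ N) {T : ℝ} (hT : 0 ≤ T) :
    Summable fun n : ℕ => 1 / ((n : ℝ) + 1) * Real.arctan (T / ((n : ℝ) + 1) ^ N) := by
  refine Summable.of_nonneg_of_le (fun n => ?_) (fun n => ?_)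
    (summable_one_div_succ_sq.mul_left T)
  · exact mul_nonneg (by positivity) (Real.arctan_nonneg.mpr (by positivity))
  · have h1 : (1 : ℝ) ≤ (n : ℝ) + 1 := by linarith [(Nat.cast_nonneg n : (0 : ℝ) ≤ n)]
    calc 1 / ((n : ℝ) + 1) * Real.arctan (T / ((n : ℝ) + 1) ^ N)
        ≤ 1 / ((n : ℝ) + 1) * (T / ((n : ℝ) + 1) ^ N) := by
          gcongr; exact arctan_le_self (by positivity)
      _ ≤ 1 / ((n : ℝ) + 1) * (T / ((n : ℝ) + 1) ^ 1) := by gcongr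
      _ = T * (1 / ((n : ℝ) + 1) ^ 2) := by field_simp

open Filter Topology in
/-- Asymptotics of `∑ arctan (T / n ^ N) / n` as `T = exp (N L)` tends to infinity. -/
theorem tendsto_tsum_arctan_div_pow {N : ℕ} (hN : 1 ≤ N) :
    Tendsto (fun L : ℝ => ∑' n : ℕ, 1 / ((n : ℝ) + 1) *
      Real.arctan (Real.exp (N * L) / ((n : ℝ) + 1) ^ N) - Real.pi / 2 * L) atTop
      (𝓝 (Real.pi / 2 * Real.eulerMascheroniConstant)) := by
  obtain ⟨l, hl⟩ := exists_tendsto_arctanExpPrimitive hN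
  have hlim : Tendsto (fun L => ∑' n, arctanExpDefect N L n) atTop
      (𝓝 (Real.pi / 2 * Real.eulerMascheroniConstant)) := by
    rw [← (hasSum_eulerMascheroni.mul_left (Real.pi / 2)).tsum_eq]
    exact tendsto_tsum_of_dominated_convergence
      (summable_one_div_succ_sq.mul_left (Real.pi / 2 + N)) (tendsto_arctanExpDefect N hN)
      (Eventually.of_forall fun L n => abs_arctanExpDefect_le N L n)
  have hkey : ∀ L : ℝ, ∑' n : ℕ, 1 / ((n : ℝ) + 1) *
      Real.arctan (Real.exp (N * L) / ((n : ℝ) + 1) ^ N) - Real.pi / 2 * L =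
      ∑' n, arctanExpDefect N L n + (l - arctanExpPrimitive N L) := by
    intro L
    have hs := (summable_arctan_div_pow hN (Real.exp_pos (N * L)).le).hasSum
    have hd : Summable (arctanExpDefect N L) :=
      Summable.of_norm_bounded (summable_one_div_succ_sq.mul_left (Real.pi / 2 + N))
        (abs_arctanExpDefect_le N L)
    have h1 := (hs.sub hd.hasSum).tendsto_sum_nat
    have hlog : Tendsto (fun n : ℕ => Real.log ((n : ℝ) + 1) - L) atTop atTop := by
      refine tendsto_atTop_add_const_right _ _ (Real.tendsto_log_atTop.comp ?_)
      exact tendsto_atTop_add_const_right _ _ tendsto_natCast_atTop_atTop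
    have h2 : Tendsto (fun n : ℕ => arctanExpPrimitive N (Real.log ((n : ℝ) + 1) - L) -
        arctanExpPrimitive N (-L)) atTop (𝓝 (l - arctanExpPrimitive N (-L))) :=
      (hl.comp hlog).sub_const _
    have h3 := tendsto_nhds_unique h1 (h2.congr fun m => ?_)
    · rw [arctanExpPrimitive_neg] at h3
      linarith
    -- The integrals telescope to a primitive between -L and log(m+1) - L.
    · have ht := Finset.sum_range_sub
        (fun n : ℕ => arctanExpPrimitive N (Real.log ((n : ℝ) + 1) - L)) m
      simp only [Nat.cast_zero, zero_add, Real.log_one, zero_sub] at ht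
      rw [← ht]
      refine Finset.sum_congr rfl fun n _ => ?_
      rw [arctan_exp_div_pow, arctanExpDefect]
      push_cast
      rw [show (n : ℝ) + 1 + 1 = n + 2 by ring]
      ring
  simp_rw [hkey]
  -- The value of l is never needed: the primitive at L tends to it, so the two cancel.
  simpa using hlim.add (tendsto_const_nhds.sub hl : Tendsto (fun L => l - arctanExpPrimitive N L)
    atTop (𝓝 (l - l)))

/-! ### The finite Fourier transform of χ -/

theorem sum_Icc_natCast_zmod {q : ℕ} [NeZero q] (f : ZMod q → ℂ) :
    ∑ r ∈ Finset.Icc 1 q, f (r : ZMod q) = ∑ j, f j := by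
  rw [← Equiv.sum_comp (Equiv.addRight (1 : ZMod q)) f]
  obtain ⟨k, rfl⟩ := Nat.exists_eq_succ_of_ne_zero (NeZero.ne q)
  rw [← Finset.Ico_add_one_right_eq_Icc, Finset.sum_Ico_eq_sum_range]
  have := Fin.sum_univ_eq_sum_range (fun i => f ((1 + i : ℕ) : ZMod (k + 1))) (k + 1)
  simp only [Nat.add_sub_cancel, Nat.succ_eq_add_one] at this ⊢
  rw [← this]
  refine Finset.sum_congr rfl fun i _ => ?_
  congr 1
  simp only [Equiv.coe_addRight]
  push_cast
  rw [add_comm]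
  congr 1
  exact Fin.cast_val_eq_self i

/-- The `m`-th coefficient `∑ χ(r) exp(2πirm/q)` of the finite Fourier transform of `χ`. -/
noncomputable def twistedSum {q : ℕ} (χ : DirichletCharacter ℂ q) (m : ℕ) : ℂ :=
  ∑ r ∈ Finset.Icc 1 q, χ (r : ZMod q) *
    Complex.exp (2 * (Real.pi : ℂ) * Complex.I * (r : ℂ) / (q : ℂ)) ^ m

open ZMod in
theorem twistedSum_eq_sum_stdAddChar {q : ℕ} [NeZero q] (χ : DirichletCharacter ℂ q) (m : ℕ) :
    twistedSum χ m = ∑ j : ZMod q, χ j * stdAddChar (j * (m : ZMod q)) := by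
  rw [← sum_Icc_natCast_zmod, twistedSum]
  refine Finset.sum_congr rfl fun r _ => ?_
  congr 1
  have := stdAddChar_coe (N := q) ((r : ℤ) * (m : ℤ))
  push_cast at this
  rw [this, ← Complex.exp_nat_mul]
  congr 1
  ring

open ZMod in
theorem gauss_eq_gaussSum {q : ℕ} [NeZero q] (χ : DirichletCharacter ℂ q) :
    LambertChar.gauss χ = gaussSum χ stdAddChar := by
  have := twistedSum_eq_sum_stdAddChar χ 1
  simp only [twistedSum, pow_one, Nat.cast_one, mul_one] at this
  exact this

-- Primitivity makes the Gauss sum separable for every m, including m not coprime to q, where both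
-- sides vanish.
open ZMod in
theorem twistedSum_eq_gauss_mul {q : ℕ} [NeZero q] {χ : DirichletCharacter ℂ q}
    (hχ : χ.IsPrimitive) (m : ℕ) :
    twistedSum χ m = LambertChar.gauss χ * (starRingEnd ℂ) (χ (m : ZMod q)) := by
  rw [gauss_eq_gaussSum, twistedSum_eq_sum_stdAddChar]
  have h := gaussSum_mulShift_of_isPrimitive (e := stdAddChar) hχ (m : ZMod q)
  rw [← MulChar.star_eq_inv, MulChar.star_apply, mul_comm] at h
  rw [starRingEnd_apply, ← h]
  simp only [gaussSum, AddChar.mulShift_apply, mul_comm]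

theorem norm_twistedSum_le {q : ℕ} [NeZero q] (χ : DirichletCharacter ℂ q) (m : ℕ) :
    ‖twistedSum χ m‖ ≤ q := by
  refine (norm_sum_le _ _).trans ?_
  calc ∑ r ∈ Finset.Icc 1 q, ‖χ (r : ZMod q) *
        Complex.exp (2 * (Real.pi : ℂ) * Complex.I * (r : ℂ) / (q : ℂ)) ^ m‖
      ≤ ∑ r ∈ Finset.Icc 1 q, (1 : ℝ) := by
        refine Finset.sum_le_sum fun r _ => ?_
        rw [norm_mul, norm_pow, show 2 * (Real.pi : ℂ) * Complex.I * (r : ℂ) / (q : ℂ) =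
          ((2 * Real.pi * r / q : ℝ) : ℂ) * Complex.I by push_cast; ring,
          Complex.norm_exp_ofReal_mul_I, one_pow, mul_one]
        exact χ.norm_le_one _
    _ = q := by simp

theorem even_apply_sub {q : ℕ} {χ : DirichletCharacter ℂ q} (hχ : χ.Even) {r : ℕ} (hr : r ≤ q) :
    χ ((q - r : ℕ) : ZMod q) = χ (r : ZMod q) := by
  rw [Nat.cast_sub hr, ZMod.natCast_self, zero_sub, hχ.eval_neg]

theorem apply_modulus_eq_zero {q : ℕ} (hq : 1 < q) (χ : DirichletCharacter ℂ q) :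
    χ (q : ZMod q) = 0 := by
  rw [ZMod.natCast_self]
  exact DirichletCharacter.map_zero' χ hq.ne'

theorem sum_Icc_mul_eq_sum_Icc_pred {q : ℕ} (hq : 1 < q) (χ : DirichletCharacter ℂ q)
    (f : ℕ → ℂ) : ∑ r ∈ Finset.Icc 1 q, χ (r : ZMod q) * f r =
      ∑ r ∈ Finset.Icc 1 (q - 1), χ (r : ZMod q) * f r := by
  obtain ⟨k, rfl⟩ : ∃ k, q = k + 1 := ⟨q - 1, by omega⟩
  rw [Finset.sum_Icc_succ_top (by omega), apply_modulus_eq_zero hq, zero_mul, add_zero]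
  rfl

theorem sum_Icc_mul_reflect {q : ℕ} {χ : DirichletCharacter ℂ q} (hχ : χ.Even) (f : ℕ → ℂ) :
    ∑ r ∈ Finset.Icc 1 (q - 1), χ (r : ZMod q) * f (q - r) =
      ∑ r ∈ Finset.Icc 1 (q - 1), χ (r : ZMod q) * f r := by
  refine Finset.sum_nbij' (fun r => q - r) (fun r => q - r) ?_ ?_ ?_ ?_ ?_
  · intro r hr; simp only [Finset.mem_Icc] at hr ⊢; omega
  · intro r hr; simp only [Finset.mem_Icc] at hr ⊢; omega
  · intro r hr; simp only [Finset.mem_Icc] at hr; omega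
  · intro r hr; simp only [Finset.mem_Icc] at hr; omega
  · intro r hr
    simp only [Finset.mem_Icc] at hr
    rw [even_apply_sub hχ (by omega)]

theorem ne_one_of_isPrimitive {q : ℕ} [NeZero q] (hq : 1 < q) {χ : DirichletCharacter ℂ q}
    (hχ : χ.IsPrimitive) : χ ≠ 1 := by
  rintro rfl
  rw [DirichletCharacter.isPrimitive_def, DirichletCharacter.conductor_one] at hχ
  omega

theorem sum_Icc_eq_zero {q : ℕ} [NeZero q] (hq : 1 < q) {χ : DirichletCharacter ℂ q}
    (hχ : χ.IsPrimitive) : ∑ r ∈ Finset.Icc 1 (q - 1), χ (r : ZMod q) = 0 := by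
  have h := sum_Icc_mul_eq_sum_Icc_pred hq χ (fun _ => 1)
  simp only [mul_one] at h
  rw [← h, sum_Icc_natCast_zmod]
  exact MulChar.sum_eq_zero_of_ne_one (ne_one_of_isPrimitive hq hχ)

theorem exp_two_pi_mul_div_ne_one {q r : ℕ} (hr : r ∈ Finset.Icc 1 (q - 1)) :
    Complex.exp (2 * (Real.pi : ℂ) * Complex.I * (r : ℂ) / (q : ℂ)) ≠ 1 := by
  simp only [Finset.mem_Icc] at hr
  have hq : q ≠ 0 := by omega
  have h := (Complex.isPrimitiveRoot_exp q hq).pow_ne_one_of_pos_of_lt (by omega)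
    (show r < q by omega)
  rwa [← Complex.exp_nat_mul, show (r : ℂ) * (2 * Real.pi * Complex.I / q) =
    2 * (Real.pi : ℂ) * Complex.I * (r : ℂ) / (q : ℂ) by ring] at h

theorem norm_exp_two_pi_mul_div (q r : ℕ) :
    ‖Complex.exp (2 * (Real.pi : ℂ) * Complex.I * (r : ℂ) / (q : ℂ))‖ = 1 := by
  rw [show 2 * (Real.pi : ℂ) * Complex.I * (r : ℂ) / (q : ℂ) =
    ((2 * Real.pi * r / q : ℝ) : ℂ) * Complex.I by push_cast; ring,
    Complex.norm_exp_ofReal_mul_I]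

/-- Evenness allows averaging over r and q - r, which turns exponentials into cosines. -/
theorem twistedSum_eq_sum_cos {q : ℕ} {χ : DirichletCharacter ℂ q} (hχ : χ.Even) (hq : 1 < q)
    (m : ℕ) : twistedSum χ m = ∑ r ∈ Finset.Icc 1 (q - 1), χ (r : ZMod q) *
      (Real.cos (2 * Real.pi * m * (r / q)) : ℂ) := by
  have hqC : (q : ℂ) ≠ 0 := Nat.cast_ne_zero.mpr (by omega)
  rw [twistedSum, sum_Icc_mul_eq_sum_Icc_pred hq χ
    (fun r => Complex.exp (2 * (Real.pi : ℂ) * Complex.I * (r : ℂ) / (q : ℂ)) ^ m)]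
  set f : ℕ → ℂ := fun r => Complex.exp (2 * (Real.pi : ℂ) * Complex.I * (r : ℂ) / (q : ℂ)) ^ m
  have h1 : ∑ r ∈ Finset.Icc 1 (q - 1), χ (r : ZMod q) * f r =
      (1 / 2) * (∑ r ∈ Finset.Icc 1 (q - 1), χ (r : ZMod q) * f r +
        ∑ r ∈ Finset.Icc 1 (q - 1), χ (r : ZMod q) * f (q - r)) := by
    rw [sum_Icc_mul_reflect hχ f]; ring
  rw [h1, ← Finset.sum_add_distrib, Finset.mul_sum]
  refine Finset.sum_congr rfl fun r hr => ?_
  simp only [Finset.mem_Icc] at hr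
  rw [← mul_add, mul_left_comm]
  congr 1
  simp only [f]
  rw [Nat.cast_sub (by omega), Complex.ofReal_cos, Complex.cos, ← Complex.exp_nat_mul,
    ← Complex.exp_nat_mul]
  have e1 : (m : ℂ) * (2 * Real.pi * Complex.I * ((q : ℂ) - r) / q) =
      -((2 * Real.pi * m * (r / q) : ℝ) : ℂ) * Complex.I + m * (2 * Real.pi * Complex.I) := by
    push_cast; field_simp; ring
  have e2 : (m : ℂ) * (2 * Real.pi * Complex.I * r / q) =
      ((2 * Real.pi * m * (r / q) : ℝ) : ℂ) * Complex.I := by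
    push_cast; field_simp
  rw [e1, e2, Complex.exp_add _ (m * (2 * Real.pi * Complex.I)),
    Complex.exp_nat_mul_two_pi_mul_I, mul_one]
  ring

/-- The residue r = q drops out because χ(q) = 0; every other r gives a bounded geometric sum with
ratio different from 1. -/
theorem exists_norm_sum_twistedSum_le {q : ℕ} (hq : 1 < q) (χ : DirichletCharacter ℂ q) :
    ∃ C : ℝ, ∀ M : ℕ, ‖∑ m ∈ Finset.range M, twistedSum χ (m + 1)‖ ≤ C := by
  refine ⟨∑ r ∈ Finset.Icc 1 (q - 1),
    2 / ‖Complex.exp (2 * (Real.pi : ℂ) * Complex.I * (r : ℂ) / (q : ℂ)) - 1‖, fun M => ?_⟩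
  have h : ∑ m ∈ Finset.range M, twistedSum χ (m + 1) =
      ∑ r ∈ Finset.Icc 1 (q - 1), χ (r : ZMod q) * ∑ m ∈ Finset.range M,
        Complex.exp (2 * (Real.pi : ℂ) * Complex.I * (r : ℂ) / (q : ℂ)) ^ (m + 1) := by
    simp_rw [Finset.mul_sum]
    rw [Finset.sum_comm]
    refine Finset.sum_congr rfl fun m _ => ?_
    exact sum_Icc_mul_eq_sum_Icc_pred hq χ _
  rw [h]
  refine (norm_sum_le _ _).trans (Finset.sum_le_sum fun r hr => ?_)
  set z := Complex.exp (2 * (Real.pi : ℂ) * Complex.I * (r : ℂ) / (q : ℂ)) with hz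
  have hz1 : z ≠ 1 := exp_two_pi_mul_div_ne_one hr
  have hzn : ‖z‖ = 1 := norm_exp_two_pi_mul_div q r
  simp_rw [pow_succ]
  rw [← Finset.sum_mul, geom_sum_eq hz1, norm_mul, norm_mul, hzn, mul_one, norm_div]
  calc ‖χ (r : ZMod q)‖ * (‖z ^ M - 1‖ / ‖z - 1‖) ≤ 1 * (2 / ‖z - 1‖) := by
        gcongr
        · exact χ.norm_le_one _
        · refine (norm_sub_le _ _).trans ?_
          rw [norm_pow, hzn, one_pow, norm_one]
          norm_num
    _ = _ := one_mul _

/-! ### The value of ∑ τ(m)/m -/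

/-- Keeps 1 - z off the branch cut, so the principal logarithm is continuous there and commutes with
conjugation. -/
theorem re_one_sub_pos {z : ℂ} (hzn : ‖z‖ = 1) (hz1 : z ≠ 1) : 0 < (1 - z).re := by
  rw [Complex.sub_re, Complex.one_re, sub_pos]
  refine lt_of_le_of_ne ((Complex.re_le_norm z).trans hzn.le) fun hre => hz1 ?_
  have h2 := Complex.sq_norm z
  rw [hzn, Complex.normSq_apply, hre] at h2
  have him : z.im = 0 := by nlinarith
  exact Complex.ext hre him

open Filter Topology in
theorem tendsto_tsum_twistedSum_mul_pow {q : ℕ} (hq : 1 < q) (χ : DirichletCharacter ℂ q) :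
    Tendsto (fun t : ℝ => ∑' m : ℕ, twistedSum χ m / (m : ℂ) * (t : ℂ) ^ m) (𝓝[<] 1)
      (𝓝 (∑ r ∈ Finset.Icc 1 (q - 1), χ (r : ZMod q) *
        -Complex.log (1 - Complex.exp (2 * (Real.pi : ℂ) * Complex.I * (r : ℂ) / (q : ℂ))))) := by
  have hlim : Tendsto (fun t : ℝ => ∑ r ∈ Finset.Icc 1 (q - 1), χ (r : ZMod q) *
        -Complex.log (1 - Complex.exp (2 * (Real.pi : ℂ) * Complex.I * (r : ℂ) / (q : ℂ)) * t))
      (𝓝[<] 1) (𝓝 (∑ r ∈ Finset.Icc 1 (q - 1), χ (r : ZMod q) *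
        -Complex.log (1 - Complex.exp (2 * (Real.pi : ℂ) * Complex.I * (r : ℂ) / (q : ℂ))))) := by
    refine tendsto_finsetSum _ fun r hr => Tendsto.const_mul _ (Tendsto.neg ?_)
    have hz1 := exp_two_pi_mul_div_ne_one hr
    have hzn := norm_exp_two_pi_mul_div q r
    set z := Complex.exp (2 * (Real.pi : ℂ) * Complex.I * (r : ℂ) / (q : ℂ))
    have hslit : 1 - z ∈ Complex.slitPlane := Or.inl (re_one_sub_pos hzn hz1)
    have hc : Tendsto (fun t : ℝ => 1 - z * (t : ℂ)) (𝓝[<] 1) (𝓝 (1 - z)) := by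
      have : Continuous fun t : ℝ => 1 - z * (t : ℂ) := by fun_prop
      have h := (this.tendsto 1).mono_left (nhdsWithin_le_nhds (s := Set.Iio 1))
      simpa using h
    exact hc.clog hslit
  refine hlim.congr' ?_
  have hmem : Set.Ioo (0 : ℝ) 1 ∈ 𝓝[<] (1 : ℝ) := Ioo_mem_nhdsLT zero_lt_one
  filter_upwards [hmem] with t ht
  symm
  have hs : ∀ r ∈ Finset.Icc 1 (q - 1), HasSum (fun m : ℕ => χ (r : ZMod q) *
      ((Complex.exp (2 * (Real.pi : ℂ) * Complex.I * (r : ℂ) / (q : ℂ)) * t) ^ m / m))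
      (χ (r : ZMod q) *
        -Complex.log (1 - Complex.exp (2 * (Real.pi : ℂ) * Complex.I * (r : ℂ) / (q : ℂ)) * t)) := by
    intro r _
    refine (Complex.hasSum_taylorSeries_neg_log ?_).mul_left _
    rw [norm_mul, norm_exp_two_pi_mul_div, one_mul, Complex.norm_real,
      Real.norm_of_nonneg ht.1.le]
    exact ht.2
  rw [← (hasSum_sum hs).tsum_eq]
  refine tsum_congr fun m => ?_
  rw [twistedSum, sum_Icc_mul_eq_sum_Icc_pred hq χ
    (fun r => Complex.exp (2 * (Real.pi : ℂ) * Complex.I * (r : ℂ) / (q : ℂ)) ^ m),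
    Finset.sum_div, Finset.sum_mul]
  refine Finset.sum_congr rfl fun r _ => ?_
  rw [mul_pow]
  ring

theorem exp_two_pi_mul_sub_div {q r : ℕ} (hr : r ≤ q) (hq : q ≠ 0) :
    Complex.exp (2 * (Real.pi : ℂ) * Complex.I * ((q - r : ℕ) : ℂ) / (q : ℂ)) =
      (starRingEnd ℂ) (Complex.exp (2 * (Real.pi : ℂ) * Complex.I * (r : ℂ) / (q : ℂ))) := by
  have hqC : (q : ℂ) ≠ 0 := Nat.cast_ne_zero.mpr hq
  rw [← Complex.exp_conj, Nat.cast_sub hr]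
  have e : 2 * (Real.pi : ℂ) * Complex.I * ((q : ℂ) - r) / q =
      (starRingEnd ℂ) (2 * (Real.pi : ℂ) * Complex.I * (r : ℂ) / (q : ℂ)) +
        2 * Real.pi * Complex.I := by
    simp only [map_div₀, map_mul, Complex.conj_ofReal, Complex.conj_I, map_natCast, map_ofNat]
    field_simp
    ring
  rw [e, Complex.exp_add, Complex.exp_two_pi_mul_I, mul_one]

theorem norm_one_sub_exp_two_pi_mul_div {q r : ℕ} (hr : r ∈ Finset.Icc 1 (q - 1)) :
    ‖1 - Complex.exp (2 * (Real.pi : ℂ) * Complex.I * (r : ℂ) / (q : ℂ))‖ =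
      2 * Real.sin (r * Real.pi / q) := by
  simp only [Finset.mem_Icc] at hr
  have hq : (0 : ℝ) < q := Nat.cast_pos.mpr (by omega)
  have hrq : (r : ℝ) ≤ q := Nat.cast_le.mpr (by omega)
  rw [norm_sub_rev, show 2 * (Real.pi : ℂ) * Complex.I * (r : ℂ) / (q : ℂ) =
    Complex.I * ((2 * Real.pi * r / q : ℝ) : ℂ) by push_cast; ring,
    Complex.norm_exp_I_mul_ofReal_sub_one,
    show 2 * Real.pi * r / q / 2 = r * Real.pi / q by ring, Real.norm_of_nonneg]
  refine mul_nonneg (by norm_num) (Real.sin_nonneg_of_nonneg_of_le_pi (by positivity) ?_)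
  rw [div_le_iff₀ hq, mul_comm Real.pi]
  gcongr

/-- Pairing r with q - r adds conjugate logarithms and leaves log|1 - e^(2πir/q)| = log 2 + log
sin(πr/q); the constant log 2 is killed by ∑ χ(r) = 0. -/
theorem sum_mul_neg_log_one_sub_exp {q : ℕ} [NeZero q] (hq : 1 < q) {χ : DirichletCharacter ℂ q}
    (hχ : χ.IsPrimitive) (heven : χ.Even) :
    ∑ r ∈ Finset.Icc 1 (q - 1), χ (r : ZMod q) *
        -Complex.log (1 - Complex.exp (2 * (Real.pi : ℂ) * Complex.I * (r : ℂ) / (q : ℂ))) =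
      -∑ r ∈ Finset.Icc 1 (q - 1), χ (r : ZMod q) *
        (Real.log (Real.sin ((r : ℝ) * Real.pi / (q : ℝ))) : ℂ) := by
  set f : ℕ → ℂ := fun r =>
    Complex.log (1 - Complex.exp (2 * (Real.pi : ℂ) * Complex.I * (r : ℂ) / (q : ℂ))) with hf
  have h1 : ∑ r ∈ Finset.Icc 1 (q - 1), χ (r : ZMod q) * f r =
      (1 / 2) * (∑ r ∈ Finset.Icc 1 (q - 1), χ (r : ZMod q) * f r +
        ∑ r ∈ Finset.Icc 1 (q - 1), χ (r : ZMod q) * f (q - r)) := by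
    rw [sum_Icc_mul_reflect heven f]; ring
  simp_rw [mul_neg]
  rw [Finset.sum_neg_distrib]
  congr 1
  change ∑ r ∈ Finset.Icc 1 (q - 1), χ (r : ZMod q) * f r = _
  rw [h1, ← Finset.sum_add_distrib, Finset.mul_sum]
  have h2 : ∀ r ∈ Finset.Icc 1 (q - 1), 1 / 2 * (χ (r : ZMod q) * f r + χ (r : ZMod q) * f (q - r))
      = χ (r : ZMod q) * (Real.log (Real.sin ((r : ℝ) * Real.pi / (q : ℝ))) : ℂ) +
        χ (r : ZMod q) * (Real.log 2 : ℝ) := by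
    intro r hr
    have hnorm := norm_one_sub_exp_two_pi_mul_div hr
    have hne : 1 - Complex.exp (2 * (Real.pi : ℂ) * Complex.I * (r : ℂ) / (q : ℂ)) ≠ 0 :=
      sub_ne_zero.mpr (exp_two_pi_mul_div_ne_one hr).symm
    have hre : 0 < (1 - Complex.exp (2 * (Real.pi : ℂ) * Complex.I * (r : ℂ) / (q : ℂ))).re :=
      re_one_sub_pos (norm_exp_two_pi_mul_div q r) (exp_two_pi_mul_div_ne_one hr)
    simp only [Finset.mem_Icc] at hr
    have hfr : f (q - r) = (starRingEnd ℂ) (f r) := by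
      simp only [hf]
      rw [exp_two_pi_mul_sub_div (by omega) (NeZero.ne q), ← map_one (starRingEnd ℂ), ← map_sub,
        Complex.log_conj, map_one]
      intro harg
      rw [Complex.arg_eq_pi_iff] at harg
      linarith [harg.1]
    have hsin : Real.sin ((r : ℝ) * Real.pi / (q : ℝ)) ≠ 0 := by
      intro h
      rw [h, mul_zero, norm_eq_zero] at hnorm
      exact hne hnorm
    have hadd : f r + (starRingEnd ℂ) (f r) = 2 * (Real.log 2 +
        Real.log (Real.sin ((r : ℝ) * Real.pi / (q : ℝ))) : ℝ) := by
      rw [Complex.add_conj]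
      simp only [hf, Complex.log_re, hnorm]
      rw [Real.log_mul two_ne_zero hsin]
      push_cast; ring
    rw [hfr, ← mul_add, hadd]
    push_cast
    ring
  rw [Finset.sum_congr rfl h2, Finset.sum_add_distrib, ← Finset.sum_mul, sum_Icc_eq_zero hq hχ,
    zero_mul, add_zero]

open Filter Topology in
/-- The value at `1` of the `L`-series with coefficients `twistedSum χ`, if it converges. -/
theorem eq_of_tendsto_sum_twistedSum_div {q : ℕ} [NeZero q] (hq : 1 < q)
    {χ : DirichletCharacter ℂ q} (hχ : χ.IsPrimitive) (heven : χ.Even) {l : ℂ}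
    (hl : Tendsto (fun M => ∑ m ∈ Finset.range M, twistedSum χ (m + 1) / ((m : ℂ) + 1)) atTop
      (𝓝 l)) :
    l = -∑ r ∈ Finset.Icc 1 (q - 1), χ (r : ZMod q) *
        (Real.log (Real.sin ((r : ℝ) * Real.pi / (q : ℝ))) : ℂ) := by
  rw [← sum_mul_neg_log_one_sub_exp hq hχ heven]
  -- The added term m = 0 is a division by zero, hence 0.
  have h1 : Tendsto (fun M => ∑ m ∈ Finset.range M, twistedSum χ m / (m : ℂ)) atTop (𝓝 l) := by
    rw [← tendsto_add_atTop_iff_nat 1]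
    refine hl.congr fun M => ?_
    rw [Finset.sum_range_succ']
    simp
  have h2 := Complex.tendsto_tsum_powerSeries_nhdsWithin_lt h1
  rw [tendsto_map'_iff] at h2
  exact tendsto_nhds_unique h2 (tendsto_tsum_twistedSum_mul_pow hq χ)

/-! ### The value L(-1, χ) -/

open ZMod in
/-- The value of `L(s, χ)` at `s = -1`, by the functional equation. -/
theorem LFunction_neg_one_eq_tsum {q : ℕ} [NeZero q] {χ : DirichletCharacter ℂ q}
    (heven : χ.Even) :
    DirichletCharacter.LFunction χ (-1) =
      -(2 * q / (4 * Real.pi ^ 2)) * ∑' m : ℕ, twistedSum χ (m + 1) / ((m : ℂ) + 1) ^ 2 := by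
  have hfe := ZMod.LFunction_one_sub (fun j : ZMod q => χ j) (s := 2)
    (fun n h => by
      have := congrArg Complex.re h
      simp at this
      have h0 : (0 : ℝ) ≤ n := Nat.cast_nonneg n
      linarith) (Or.inr (by norm_num))
  -- By evenness the two Fourier transforms in the functional equation coincide; at s = 2 both
  -- exponential factors are -1, whence -2.
  have hneg : (fun j : ZMod q => χ (-j)) = fun j => χ j := by
    ext j; rw [heven.eval_neg]
  rw [hneg] at hfe
  have hdft : ∀ m : ℕ, 𝓕 (fun j : ZMod q => χ j) (m : ZMod q) = twistedSum χ m := by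
    intro m
    rw [twistedSum_eq_sum_stdAddChar, dft_apply, ← Equiv.sum_comp (Equiv.neg (ZMod q))]
    refine Finset.sum_congr rfl fun j _ => ?_
    simp [heven.eval_neg, mul_comm]
  have hL : ZMod.LFunction (𝓕 (fun j : ZMod q => χ j)) 2 =
      ∑' m : ℕ, twistedSum χ (m + 1) / ((m : ℂ) + 1) ^ 2 := by
    rw [ZMod.LFunction_eq_LSeries _ (by norm_num), LSeries]
    have hs : Summable fun n : ℕ => LSeries.term
        (fun n : ℕ => 𝓕 (fun j : ZMod q => χ j) (n : ZMod q)) 2 n :=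
      ZMod.LSeriesSummable_of_one_lt_re _ (by norm_num)
    rw [hs.tsum_eq_zero_add, LSeries.term_zero, zero_add]
    refine tsum_congr fun m => ?_
    rw [LSeries.term_of_ne_zero (Nat.succ_ne_zero m), hdft]
    push_cast
    norm_num
  rw [hL] at hfe
  have e1 : Complex.exp (Real.pi * Complex.I * 2 / 2) = -1 := by
    rw [mul_div_cancel_right₀ _ (two_ne_zero' ℂ), Complex.exp_pi_mul_I]
  have e2 : Complex.exp (-Real.pi * Complex.I * 2 / 2) = -1 := by
    rw [mul_div_cancel_right₀ _ (two_ne_zero' ℂ), neg_mul, Complex.exp_neg, Complex.exp_pi_mul_I]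
    norm_num
  have e3 : Complex.Gamma 2 = 1 := by simp
  have e4 : (2 * Real.pi : ℂ) ^ (-2 : ℂ) = 1 / (4 * Real.pi ^ 2) := by
    rw [Complex.cpow_neg, Complex.cpow_ofNat, mul_pow]
    norm_num
  rw [e1, e2, e3, e4, show (2 - 1 : ℂ) = 1 by norm_num, show (1 - 2 : ℂ) = -1 by norm_num,
    Complex.cpow_one] at hfe
  rw [DirichletCharacter.LFunction]
  refine hfe.trans ?_
  ring

/-! ### The kernel in m and its truncated sums -/

/-- The Poisson-type kernel `2y / (y² + 4π²t²)`. -/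
noncomputable def poissonTerm (y t : ℝ) : ℝ := 2 * y / (y ^ 2 + 4 * Real.pi ^ 2 * t ^ 2)

theorem poissonTerm_nonneg {y : ℝ} (hy : 0 < y) (t : ℝ) : 0 ≤ poissonTerm y t := by
  unfold poissonTerm; positivity

theorem poissonTerm_zero {y : ℝ} (hy : 0 < y) : poissonTerm y 0 = 2 / y := by
  unfold poissonTerm; field_simp; ring

theorem poissonTerm_le {y s t : ℝ} (hy : 0 < y) (hs : 0 ≤ s) (hst : s ≤ t) :
    poissonTerm y t ≤ poissonTerm y s := by
  unfold poissonTerm; gcongr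

/-- A primitive of the kernel `poissonTerm y`. -/
noncomputable def poissonPrimitive (y t : ℝ) : ℝ := 1 / Real.pi * Real.arctan (2 * Real.pi * t / y)

theorem hasDerivAt_poissonPrimitive {y : ℝ} (hy : 0 < y) (t : ℝ) :
    HasDerivAt (poissonPrimitive y) (poissonTerm y t) t := by
  have h := ((((hasDerivAt_id t).const_mul (2 * Real.pi)).div_const y).arctan).const_mul
    (1 / Real.pi)
  refine h.congr_deriv ?_
  have hpi := Real.pi_pos
  simp only [poissonTerm, id]
  field_simp
  ring

theorem exists_poissonPrimitive_sub_eq {y : ℝ} (hy : 0 < y) (m : ℕ) :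
    ∃ t ∈ Set.Ioo (m : ℝ) (m + 1),
      poissonPrimitive y ((m : ℝ) + 1) - poissonPrimitive y m = poissonTerm y t := by
  obtain ⟨t, ht, h⟩ := exists_hasDerivAt_eq_slope (poissonPrimitive y) (poissonTerm y)
    (show (m : ℝ) < m + 1 by linarith)
    (fun t _ => (hasDerivAt_poissonPrimitive hy t).continuousAt.continuousWithinAt)
    (fun t _ => hasDerivAt_poissonPrimitive hy t)
  exact ⟨t, ht, by rw [h]; simp⟩

/-- Integral test: the kernel decreases, so sum and integral differ by at most its value 2/y at 0.
-/
theorem abs_sum_poissonTerm_sub_primitive_le {y : ℝ} (hy : 0 < y) (M : ℕ) :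
    |∑ m ∈ Finset.range M, poissonTerm y ((m : ℝ) + 1) - poissonPrimitive y M| ≤ 2 / y := by
  have h0 : poissonPrimitive y (0 : ℕ) = 0 := by simp [poissonPrimitive]
  have h : poissonPrimitive y M =
      ∑ m ∈ Finset.range M, (poissonPrimitive y ((m : ℝ) + 1) - poissonPrimitive y m) := by
    have := Finset.sum_range_sub (fun m : ℕ => poissonPrimitive y m) M
    rw [h0, sub_zero] at this
    rw [← this]
    push_cast
    rfl
  have hle : ∑ m ∈ Finset.range M, poissonTerm y ((m : ℝ) + 1) ≤ poissonPrimitive y M := by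
    rw [h]
    refine Finset.sum_le_sum fun m _ => ?_
    obtain ⟨t, ht, e⟩ := exists_poissonPrimitive_sub_eq hy m
    rw [e]
    exact poissonTerm_le hy ((Nat.cast_nonneg m).trans ht.1.le) ht.2.le
  have hge : poissonPrimitive y M ≤ ∑ m ∈ Finset.range M, poissonTerm y m := by
    rw [h]
    refine Finset.sum_le_sum fun m _ => ?_
    obtain ⟨t, ht, e⟩ := exists_poissonPrimitive_sub_eq hy m
    rw [e]
    exact poissonTerm_le hy (Nat.cast_nonneg m) ht.1.le
  have htel := Finset.sum_range_sub (fun m : ℕ => poissonTerm y m) M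
  rw [Finset.sum_sub_distrib] at htel
  push_cast at htel
  rw [poissonTerm_zero hy] at htel
  have := poissonTerm_nonneg hy M
  rw [abs_of_nonpos (by linarith)]
  linarith

/-- Abel summation, with the decrements of f telescoping. -/
theorem norm_sum_mul_le_of_antitone {a : ℕ → ℂ} {f : ℕ → ℝ} {C : ℝ}
    (ha : ∀ M, ‖∑ m ∈ Finset.range M, a m‖ ≤ C) (hf : Antitone f) (hf0 : ∀ m, 0 ≤ f m) (M : ℕ) :
    ‖∑ m ∈ Finset.range M, a m * f m‖ ≤ C * f 0 := by
  have hC : 0 ≤ C := (norm_nonneg _).trans (ha 0)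
  have key : ∀ M, ∑ m ∈ Finset.range M, a m * f m =
      ∑ m ∈ Finset.range M, (∑ k ∈ Finset.range (m + 1), a k) * ((f m - f (m + 1) : ℝ) : ℂ) +
        (∑ m ∈ Finset.range M, a m) * f M := by
    intro M
    induction M with
    | zero => simp
    | succ M ih =>
      rw [Finset.sum_range_succ, ih, Finset.sum_range_succ _ M,
        Finset.sum_range_succ a M]
      push_cast
      ring
  rw [key]
  refine (norm_add_le _ _).trans ?_
  have h1 : ‖∑ m ∈ Finset.range M, (∑ k ∈ Finset.range (m + 1), a k) *
      ((f m - f (m + 1) : ℝ) : ℂ)‖ ≤ ∑ m ∈ Finset.range M, C * (f m - f (m + 1)) := by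
    refine (norm_sum_le _ _).trans (Finset.sum_le_sum fun m _ => ?_)
    rw [norm_mul, Complex.norm_real, Real.norm_of_nonneg (sub_nonneg.mpr (hf m.le_succ))]
    exact mul_le_mul_of_nonneg_right (ha _) (sub_nonneg.mpr (hf m.le_succ))
  have h2 : ‖(∑ m ∈ Finset.range M, a m) * (f M : ℂ)‖ ≤ C * f M := by
    rw [norm_mul, Complex.norm_real, Real.norm_of_nonneg (hf0 M)]
    exact mul_le_mul_of_nonneg_right (ha M) (hf0 M)
  rw [← Finset.mul_sum, Finset.sum_range_sub'] at h1
  linarith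

/-- Partial fraction expansion of `1 / (exp y - 1)`. -/
theorem hasSum_poissonTerm {y : ℝ} (hy : 0 < y) :
    HasSum (fun m : ℕ => poissonTerm y ((m : ℝ) + 1))
      (Real.exp (-y) / (1 - Real.exp (-y)) - 1 / y + 1 / 2) := by
  have h := (hasSum_cos_div_sq_add_sq hy (a := 0) ⟨le_rfl, zero_le_one⟩).div_const 2
  have hE : 1 - Real.exp (-y) ≠ 0 := by
    have := Real.exp_lt_one_iff.mpr (show -y < 0 by linarith)
    linarith
  convert! h using 1
  · ext m
    simp only [mul_zero, Real.cos_zero, mul_one, poissonTerm]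
    ring
  · simp only [neg_zero, zero_mul, Real.exp_zero, sub_zero, neg_mul, one_mul]
    field_simp
    ring

/-- Partial fraction expansion of `∑ χ(r) exp (-r y / q) / (1 - exp (-y))`. -/
theorem hasSum_twistedSum_mul_poissonTerm {q : ℕ} [NeZero q] (hq : 1 < q)
    {χ : DirichletCharacter ℂ q} (hχ : χ.IsPrimitive) (heven : χ.Even) {y : ℝ} (hy : 0 < y) :
    HasSum (fun m : ℕ => twistedSum χ (m + 1) * (poissonTerm y ((m : ℝ) + 1) : ℂ))
      (∑ r ∈ Finset.Icc 1 q, χ (r : ZMod q) *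
        ((Real.exp (-((r : ℝ) / q) * y) / (1 - Real.exp (-y)) : ℝ) : ℂ)) := by
  have hqR : (0 : ℝ) < q := Nat.cast_pos.mpr (by omega)
  set g : ℕ → ℂ := fun r => ((Real.exp (-((r : ℝ) / q) * y) / (1 - Real.exp (-y)) : ℝ) : ℂ)
    with hg
  -- The 1/y term has coefficient ∑ χ(r) = 0; it is inserted to match the zero mode of each cosine
  -- series.
  have h1 : ∑ r ∈ Finset.Icc 1 q, χ (r : ZMod q) * g r =
      (1 / 2) * (∑ r ∈ Finset.Icc 1 (q - 1), χ (r : ZMod q) * g r +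
        ∑ r ∈ Finset.Icc 1 (q - 1), χ (r : ZMod q) * g (q - r)) -
        (∑ r ∈ Finset.Icc 1 (q - 1), χ (r : ZMod q)) * (1 / y) := by
    rw [sum_Icc_mul_eq_sum_Icc_pred hq, sum_Icc_mul_reflect heven g, sum_Icc_eq_zero hq hχ]; ring
  change HasSum _ (∑ r ∈ Finset.Icc 1 q, χ (r : ZMod q) * g r)
  rw [h1, ← Finset.sum_add_distrib, Finset.mul_sum, Finset.sum_mul, ← Finset.sum_sub_distrib]
  have hs : ∀ r ∈ Finset.Icc 1 (q - 1), HasSum (fun m : ℕ => χ (r : ZMod q) *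
      ((Real.cos (2 * Real.pi * ((m + 1 : ℕ) : ℝ) * (r / q)) : ℂ) *
        (poissonTerm y ((m : ℝ) + 1) : ℂ)))
      (1 / 2 * (χ (r : ZMod q) * g r + χ (r : ZMod q) * g (q - r)) -
        χ (r : ZMod q) * (1 / y)) := by
    intro r hr
    simp only [Finset.mem_Icc] at hr
    have hrq : (r : ℝ) / q ∈ Set.Icc (0 : ℝ) 1 := by
      refine ⟨by positivity, (div_le_one hqR).mpr ?_⟩
      exact Nat.cast_le.mpr (by omega)
    have h := (hasSum_cos_div_sq_add_sq hy hrq).div_const 2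
    have h' := (Complex.hasSum_ofReal.mpr h).mul_left (χ (r : ZMod q))
    convert! h' using 1
    · ext m
      congr 1
      rw [← Complex.ofReal_mul]
      congr 1
      simp only [poissonTerm]
      push_cast
      ring
    · simp only [hg]
      rw [Nat.cast_sub (by omega)]
      have e : ((q : ℝ) - r) / q = 1 - r / q := by field_simp
      rw [e]
      push_cast
      ring
  convert! hasSum_sum hs using 1
  ext m
  rw [twistedSum_eq_sum_cos heven hq, Finset.sum_mul]
  exact Finset.sum_congr rfl fun r _ => by ring

/-- The inner sum of the dual series. -/
noncomputable def dualInner (N : ℕ) (x : ℝ) (t : ℝ) : ℂ :=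
  LambertChar.doublePrimeSum N fun j : ℤ =>
      Complex.exp (Complex.I * (Real.pi : ℂ) * (j : ℂ) / 2) /
        (Complex.exp (2 * (Real.pi : ℂ) *
            (((2 * Real.pi * t / x) ^ (1 / (N : ℝ)) : ℝ) : ℂ) *
            Complex.exp (-(Complex.I * (Real.pi : ℂ) * (j : ℂ)) / (2 * (N : ℂ)))) - 1)

theorem dualTerm_eq {q : ℕ} (χ : DirichletCharacter ℂ q) (N : ℕ) (x : ℝ) (n : ℕ) :
    LambertChar.dualTerm χ N x n =
      (starRingEnd ℂ) (χ (n : ZMod q)) / (n : ℂ) * dualInner N x n := rfl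

/-- Factoring x² out of the denominator reduces this to `hasSum_pow_div_pow_add_sq` with T = 2πt/x.
-/
theorem hasSum_poissonTerm_div {N h : ℕ} (hN : N = 2 * h + 1) {x t : ℝ} (hx : 0 < x)
    (ht : 0 < t) :
    HasSum (fun n : ℕ => 1 / ((n : ℂ) + 1) * (poissonTerm (((n : ℝ) + 1) ^ N * x) t : ℂ))
      (1 / (2 * N * t) + (-1) ^ h * (1 / (N * t)) * dualInner N x t -
        (if N = 1 then (x : ℂ) / (4 * Real.pi ^ 2) else 0) * (1 / (t : ℂ) ^ 2)) := by
  have hT : 0 < 2 * Real.pi * t / x := by positivity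
  have hxC : (x : ℂ) ≠ 0 := Complex.ofReal_ne_zero.mpr hx.ne'
  have htC : (t : ℂ) ≠ 0 := Complex.ofReal_ne_zero.mpr ht.ne'
  have hpC : (Real.pi : ℂ) ≠ 0 := Complex.ofReal_ne_zero.mpr Real.pi_ne_zero
  have hNC : (N : ℂ) ≠ 0 := Nat.cast_ne_zero.mpr (by omega)
  have h1 := (hasSum_pow_div_pow_add_sq hN hT).mul_left (2 / (x : ℂ))
  convert! h1 using 1
  · ext n
    have e : (1 / ((n : ℝ) + 1) * poissonTerm (((n : ℝ) + 1) ^ N * x) t) =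
        2 / x * (((n : ℝ) + 1) ^ (N - 1) / (((n : ℝ) + 1) ^ (2 * N) +
          (2 * Real.pi * t / x) ^ 2)) := by
      have hpow : ((n : ℝ) + 1) ^ N = ((n : ℝ) + 1) ^ (N - 1) * (n + 1) := by
        rw [← pow_succ]; congr 1; omega
      have h2 : ((n : ℝ) + 1) ^ (2 * N) = (((n : ℝ) + 1) ^ (N - 1) * (n + 1)) ^ 2 := by
        rw [mul_comm 2 N, pow_mul, hpow]
      unfold poissonTerm
      rw [h2, hpow]
      have : (0 : ℝ) < (n : ℝ) + 1 := by positivity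
      field_simp
      ring
    have e' := congrArg (fun r : ℝ => (r : ℂ)) e
    push_cast at e' ⊢
    exact e'
  · rw [← dualInner]
    split_ifs
    · push_cast
      field_simp
      ring
    · push_cast
      field_simp
      ring

/-! ### Interchange of summations -/

open Filter Topology in
/-- Interchange of the summations over `n` and `m`. -/
theorem tendsto_sum_mul_tsum_poissonTerm {N : ℕ} (hN : 1 ≤ N) {x : ℝ} (hx : 0 < x) {a : ℕ → ℂ}
    {c C : ℝ} {g : ℝ → ℂ}
    (hlim : ∀ y : ℝ, 0 < y → Tendsto (fun M : ℕ => ∑ m ∈ Finset.range M,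
      a m * (poissonTerm y ((m : ℝ) + 1) : ℂ) - (c * poissonPrimitive y M : ℝ)) atTop (𝓝 (g y)))
    (hbound : ∀ y : ℝ, 0 < y → ∀ M : ℕ, ‖∑ m ∈ Finset.range M,
      a m * (poissonTerm y ((m : ℝ) + 1) : ℂ) - (c * poissonPrimitive y M : ℝ)‖ ≤ C * (2 / y))
    {S : ℕ → ℂ} (hS : ∀ m : ℕ, HasSum (fun n : ℕ => 1 / ((n : ℂ) + 1) *
      (poissonTerm (((n : ℝ) + 1) ^ N * x) ((m : ℝ) + 1) : ℂ)) (S m)) :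
    Tendsto (fun M : ℕ => ∑ m ∈ Finset.range M, a m * S m -
      ((c / Real.pi * ∑' n : ℕ, 1 / ((n : ℝ) + 1) *
        Real.arctan (2 * Real.pi * M / x / ((n : ℝ) + 1) ^ N) : ℝ) : ℂ)) atTop
      (𝓝 (∑' n : ℕ, 1 / ((n : ℂ) + 1) * g (((n : ℝ) + 1) ^ N * x))) := by
  have hy : ∀ n : ℕ, 0 < ((n : ℝ) + 1) ^ N * x := fun n => by positivity
  have hC : 0 ≤ C := by
    have := (norm_nonneg _).trans (hbound 1 one_pos 0)
    linarith
  -- The bound C·2/y with y = (n+1)^N x, weighted by 1/(n+1), is at most C(2/x)/(n+1)²,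
  -- independently of M.
  have hmain := tendsto_tsum_of_dominated_convergence
    (𝓕 := atTop) (f := fun (M : ℕ) (n : ℕ) => 1 / ((n : ℂ) + 1) *
      (∑ m ∈ Finset.range M, a m * (poissonTerm (((n : ℝ) + 1) ^ N * x) ((m : ℝ) + 1) : ℂ) -
        (c * poissonPrimitive (((n : ℝ) + 1) ^ N * x) M : ℝ)))
    (summable_one_div_succ_sq.mul_left (C * (2 / x)))
    (fun n => (hlim _ (hy n)).const_mul (1 / ((n : ℂ) + 1)))
    (Eventually.of_forall fun M n => ?_)
  · refine hmain.congr fun M => ?_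
    have h1 : HasSum (fun n : ℕ => ∑ m ∈ Finset.range M, a m * (1 / ((n : ℂ) + 1) *
        (poissonTerm (((n : ℝ) + 1) ^ N * x) ((m : ℝ) + 1) : ℂ)))
        (∑ m ∈ Finset.range M, a m * S m) :=
      hasSum_sum fun m _ => (hS m).mul_left (a m)
    have h2 := Complex.hasSum_ofReal.mpr ((summable_arctan_div_pow hN
      (show 0 ≤ 2 * Real.pi * M / x by positivity)).hasSum.mul_left (c / Real.pi))
    rw [← (h1.sub h2).tsum_eq]
    refine tsum_congr fun n => ?_
    rw [mul_sub, Finset.mul_sum]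
    congr 1
    · exact Finset.sum_congr rfl fun m _ => by ring
    · rw [poissonPrimitive, div_div, mul_comm x]
      push_cast
      ring
  · have hn1 : (1 : ℝ) ≤ (n : ℝ) + 1 := by linarith [(Nat.cast_nonneg n : (0 : ℝ) ≤ n)]
    rw [norm_mul]
    have e : ‖1 / ((n : ℂ) + 1)‖ = 1 / ((n : ℝ) + 1) := by
      rw [show 1 / ((n : ℂ) + 1) = ((1 / ((n : ℝ) + 1) : ℝ) : ℂ) by push_cast; rfl,
        Complex.norm_real, Real.norm_of_nonneg (by positivity)]
    rw [e]
    calc 1 / ((n : ℝ) + 1) * _ ≤ 1 / ((n : ℝ) + 1) * (C * (2 / (((n : ℝ) + 1) ^ N * x))) := by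
          gcongr; exact hbound _ (hy n) M
      _ ≤ 1 / ((n : ℝ) + 1) * (C * (2 / (((n : ℝ) + 1) ^ 1 * x))) := by gcongr
      _ = C * (2 / x) * (1 / ((n : ℝ) + 1) ^ 2) := by field_simp

/-! ### Absolute convergence and the constants -/

theorem summable_lambertTerm {q : ℕ} (χ : DirichletCharacter ℂ q) {N : ℕ} (hN : 1 ≤ N) {x : ℝ}
    (hx : 0 < x) {r : ℕ} (hr : r ∈ Finset.Icc 1 q) :
    Summable fun n : ℕ => LambertChar.lambertTerm χ N x r (n + 1) := by
  simp only [Finset.mem_Icc] at hr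
  have hqR : (0 : ℝ) < q := Nat.cast_pos.mpr (by omega)
  have hrR : (0 : ℝ) < r := Nat.cast_pos.mpr (by omega)
  have hE : 0 < 1 - Real.exp (-x) := sub_pos.mpr (Real.exp_lt_one_iff.mpr (by linarith))
  have hgeo : Summable fun n : ℕ => Real.exp (-(r / q * x)) ^ n * (1 / (1 - Real.exp (-x))) := by
    refine (summable_geometric_of_lt_one (Real.exp_pos _).le ?_).mul_right _
    exact Real.exp_lt_one_iff.mpr (neg_lt_zero.mpr (by positivity))
  refine Summable.of_norm_bounded hgeo fun n => ?_
  have hn1 : (1 : ℝ) ≤ ((n + 1 : ℕ) : ℝ) := by exact_mod_cast Nat.le_add_left 1 n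
  have hpow : ((n + 1 : ℕ) : ℝ) ≤ ((n + 1 : ℕ) : ℝ) ^ N := le_self_pow₀ hn1 (by omega)
  have hnn : (n : ℝ) ≤ ((n + 1 : ℕ) : ℝ) := by push_cast; linarith
  have hden : 1 - Real.exp (-x) ≤ 1 - Real.exp (-((n + 1 : ℕ) : ℝ) ^ N * x) := by
    have : Real.exp (-((n + 1 : ℕ) : ℝ) ^ N * x) ≤ Real.exp (-x) := by
      refine Real.exp_le_exp.mpr ?_
      nlinarith
    linarith
  have hnum : Real.exp (-((r : ℝ) / q) * ((n + 1 : ℕ) : ℝ) ^ N * x) ≤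
      Real.exp (-(r / q * x)) ^ n := by
    rw [← Real.exp_nat_mul]
    refine Real.exp_le_exp.mpr ?_
    have h3 : (r : ℝ) / q * x * n ≤ r / q * x * ((n + 1 : ℕ) : ℝ) ^ N := by
      gcongr; exact hnn.trans hpow
    linarith
  have hχ : ‖χ (r : ZMod q) / ((n + 1 : ℕ) : ℂ)‖ ≤ 1 := by
    rw [norm_div, Complex.norm_natCast]
    exact (div_le_one (by linarith)).mpr ((χ.norm_le_one _).trans hn1)
  have hnonneg : 0 ≤ Real.exp (-((r : ℝ) / q) * ((n + 1 : ℕ) : ℝ) ^ N * x) /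
      (1 - Real.exp (-((n + 1 : ℕ) : ℝ) ^ N * x)) :=
    div_nonneg (Real.exp_pos _).le (hE.le.trans hden)
  rw [LambertChar.lambertTerm, norm_mul, Complex.norm_real, Real.norm_of_nonneg hnonneg,
    mul_one_div]
  exact (mul_le_mul hχ (div_le_div₀ (by positivity) hnum hE hden) hnonneg zero_le_one).trans
    (one_mul _).le

theorem sum_tsum_lambertTerm {q : ℕ} (χ : DirichletCharacter ℂ q) {N : ℕ} (hN : 1 ≤ N) {x : ℝ}
    (hx : 0 < x) :
    ∑ r ∈ Finset.Icc 1 q, ∑' n : ℕ, LambertChar.lambertTerm χ N x r (n + 1) =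
      ∑' n : ℕ, 1 / ((n : ℂ) + 1) * ∑ r ∈ Finset.Icc 1 q, χ (r : ZMod q) *
        ((Real.exp (-((r : ℝ) / q) * (((n : ℝ) + 1) ^ N * x)) /
          (1 - Real.exp (-(((n : ℝ) + 1) ^ N * x))) : ℝ) : ℂ) := by
  rw [← Summable.tsum_finsetSum fun r hr => summable_lambertTerm χ hN hx hr]
  refine tsum_congr fun n => ?_
  rw [Finset.mul_sum]
  refine Finset.sum_congr rfl fun r _ => ?_
  rw [LambertChar.lambertTerm, neg_mul (((n + 1 : ℕ) : ℝ) ^ N) x, mul_assoc (-((r : ℝ) / q))]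
  push_cast
  ring

/-- Uses |e^z - 1| ≥ e^(Re z) - 1 ≥ Re z > 0. This power decay, far from sharp, already makes the
dual series converge absolutely. -/
theorem norm_dualInner_le {N : ℕ} {x : ℝ} (hx : 0 < x) :
    ∃ C : ℝ, 0 ≤ C ∧ ∀ t : ℝ, 0 < t → ‖dualInner N x t‖ ≤ C * (t ^ (1 / (N : ℝ)))⁻¹ := by
  let e : ℕ → ℂ := fun k => Complex.exp
    (-(Complex.I * Real.pi * ((2 * (k : ℤ) - ((N : ℤ) - 1) : ℤ) : ℂ)) / (2 * N))
  have he : ∀ k ∈ Finset.range N, 0 < (e k).re := fun k hk =>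
    re_exp_doublePrimeSum_index_pos (Finset.mem_range.mp hk)
  refine ⟨∑ k ∈ Finset.range N,
    (2 * Real.pi * (2 * Real.pi / x) ^ (1 / (N : ℝ)) * (e k).re)⁻¹, ?_, fun t ht => ?_⟩
  · exact Finset.sum_nonneg fun k hk => by have := he k hk; positivity
  · rw [dualInner, LambertChar.doublePrimeSum, Finset.sum_mul]
    refine (norm_sum_le _ _).trans (Finset.sum_le_sum fun k hk => ?_)
    have hek := he k hk
    have hρ : (2 * Real.pi * t / x) ^ (1 / (N : ℝ)) =
        (2 * Real.pi / x) ^ (1 / (N : ℝ)) * t ^ (1 / (N : ℝ)) := by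
      rw [← Real.mul_rpow (by positivity) ht.le]; congr 1; ring
    rw [norm_div]
    have h1 : ‖Complex.exp (Complex.I * Real.pi *
        ((2 * (k : ℤ) - ((N : ℤ) - 1) : ℤ) : ℂ) / 2)‖ = 1 := by
      rw [show Complex.I * Real.pi * ((2 * (k : ℤ) - ((N : ℤ) - 1) : ℤ) : ℂ) / 2 =
        ((Real.pi * ((2 * (k : ℤ) - ((N : ℤ) - 1) : ℤ) : ℝ) / 2 : ℝ) : ℂ) * Complex.I by
          push_cast; ring, Complex.norm_exp_ofReal_mul_I]
    rw [h1, ← mul_inv, one_div]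
    have hpos : 0 < 2 * Real.pi * (2 * Real.pi / x) ^ (1 / (N : ℝ)) * (e k).re *
        t ^ (1 / (N : ℝ)) := by positivity
    refine inv_anti₀ hpos ?_
    set z : ℂ := 2 * Real.pi * (((2 * Real.pi * t / x) ^ (1 / (N : ℝ)) : ℝ) : ℂ) * e k with hz
    have hzre : z.re = 2 * Real.pi * (2 * Real.pi / x) ^ (1 / (N : ℝ)) * (e k).re *
        t ^ (1 / (N : ℝ)) := by
      rw [hz, hρ, show (2 * (Real.pi : ℂ) * (((2 * Real.pi / x) ^ (1 / (N : ℝ)) *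
        t ^ (1 / (N : ℝ)) : ℝ) : ℂ)) = ((2 * Real.pi * ((2 * Real.pi / x) ^ (1 / (N : ℝ)) *
        t ^ (1 / (N : ℝ))) : ℝ) : ℂ) by push_cast; ring, Complex.re_ofReal_mul]
      ring
    rw [← hzre]
    calc z.re ≤ Real.exp z.re - 1 := by linarith [Real.add_one_le_exp z.re]
      _ = ‖Complex.exp z‖ - ‖(1 : ℂ)‖ := by rw [Complex.norm_exp, norm_one]
      _ ≤ ‖Complex.exp z - 1‖ := norm_sub_norm_le _ _

theorem summable_dualTerm {q : ℕ} (χ : DirichletCharacter ℂ q) {N : ℕ} (hN : 1 ≤ N) {x : ℝ}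
    (hx : 0 < x) : Summable fun n : ℕ => LambertChar.dualTerm χ N x (n + 1) := by
  obtain ⟨C, hC, hbound⟩ := norm_dualInner_le (N := N) hx
  have hp : 1 < 1 + 1 / (N : ℝ) := by
    have : (0 : ℝ) < N := Nat.cast_pos.mpr hN
    have : 0 < 1 / (N : ℝ) := by positivity
    linarith
  have hs := (summable_nat_add_iff 1).mpr (Real.summable_one_div_nat_rpow.mpr hp)
  refine Summable.of_norm_bounded (hs.mul_left C) fun n => ?_
  have hn : (0 : ℝ) < ((n + 1 : ℕ) : ℝ) := Nat.cast_pos.mpr n.succ_pos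
  rw [dualTerm_eq, norm_mul, norm_div, Complex.norm_natCast, RCLike.norm_conj,
    Real.rpow_add hn, Real.rpow_one]
  calc _ ≤ 1 / ((n + 1 : ℕ) : ℝ) * (C * (((n + 1 : ℕ) : ℝ) ^ (1 / (N : ℝ)))⁻¹) := by
        gcongr
        · exact χ.norm_le_one _
        · exact hbound _ hn
    _ = _ := by field_simp

theorem summable_twistedSum_div_sq {q : ℕ} [NeZero q] (χ : DirichletCharacter ℂ q) :
    Summable fun m : ℕ => twistedSum χ (m + 1) / ((m : ℂ) + 1) ^ 2 := by
  refine Summable.of_norm_bounded (summable_one_div_succ_sq.mul_left (q : ℝ)) fun m => ?_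
  have e : ‖((m : ℂ) + 1) ^ 2‖ = ((m : ℝ) + 1) ^ 2 := by
    rw [norm_pow]
    congr 1
    exact_mod_cast Complex.norm_natCast (m + 1)
  rw [norm_div, e, mul_one_div]
  gcongr
  exact norm_twistedSum_le χ _

theorem RN_eq_tsum {q : ℕ} [NeZero q] {χ : DirichletCharacter ℂ q} (heven : χ.Even) (N : ℕ)
    (x : ℝ) : LambertChar.RN χ N x = -(if N = 1 then (x : ℂ) / (4 * Real.pi ^ 2) else 0) *
      ∑' m : ℕ, twistedSum χ (m + 1) / ((m : ℂ) + 1) ^ 2 := by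
  unfold LambertChar.RN
  split_ifs
  · rw [LFunction_neg_one_eq_tsum heven]
    have hq : (q : ℂ) ≠ 0 := Nat.cast_ne_zero.mpr (NeZero.ne q)
    field_simp
  · simp

theorem K_eq_tsum {q : ℕ} (χ : DirichletCharacter ℂ q) {N h : ℕ} (hN : N = 2 * h + 1) (x : ℝ) :
    LambertChar.K χ N x = (-1) ^ h * (LambertChar.gauss χ / N) *
      ∑' n : ℕ, LambertChar.dualTerm χ N x (n + 1) := by
  rw [LambertChar.K, tsum_pnat_eq_tsum_succ (f := fun n => LambertChar.dualTerm χ N x n),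
    show (N + 3) / 2 = h + 2 by omega, pow_add]
  norm_num

/-! ### The identity for q > 1 and for q = 1 -/

-- Common to both cases, with c = 0 for q > 1 and c = 1 for q = 1: the dual and 1/m² parts converge
-- separately and move to the limit, leaving only the conditionally convergent or divergent part
-- 1/m.
open Filter Topology in
theorem tendsto_sum_twistedSum_div_sub {q : ℕ} [NeZero q] {χ : DirichletCharacter ℂ q}
    (hχ : χ.IsPrimitive) (heven : χ.Even) {N : ℕ} (hN : Odd N) {x : ℝ} (hx : 0 < x)
    {c C : ℝ} {g : ℝ → ℂ}
    (hlim : ∀ y : ℝ, 0 < y → Tendsto (fun M : ℕ => ∑ m ∈ Finset.range M, twistedSum χ (m + 1) *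
      (poissonTerm y ((m : ℝ) + 1) : ℂ) - (c * poissonPrimitive y M : ℝ)) atTop (𝓝 (g y)))
    (hbound : ∀ y : ℝ, 0 < y → ∀ M : ℕ, ‖∑ m ∈ Finset.range M, twistedSum χ (m + 1) *
      (poissonTerm y ((m : ℝ) + 1) : ℂ) - (c * poissonPrimitive y M : ℝ)‖ ≤ C * (2 / y)) :
    Tendsto (fun M : ℕ => 1 / (2 * (N : ℂ)) *
      ∑ m ∈ Finset.range M, twistedSum χ (m + 1) / ((m : ℂ) + 1) -
      ((c / Real.pi * ∑' n : ℕ, 1 / ((n : ℝ) + 1) *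
        Real.arctan (2 * Real.pi * M / x / ((n : ℝ) + 1) ^ N) : ℝ) : ℂ)) atTop
      (𝓝 (∑' n : ℕ, 1 / ((n : ℂ) + 1) * g (((n : ℝ) + 1) ^ N * x) - LambertChar.K χ N x -
        LambertChar.RN χ N x)) := by
  obtain ⟨h, hNh⟩ := hN
  have hN1 : 1 ≤ N := by omega
  have h1 := tendsto_sum_mul_tsum_poissonTerm hN1 hx hlim hbound
    (fun m => hasSum_poissonTerm_div hNh hx (show (0 : ℝ) < (m : ℝ) + 1 by positivity))
  have h2 := ((summable_dualTerm χ hN1 hx).hasSum.tendsto_sum_nat).const_mul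
    ((-1) ^ h * (LambertChar.gauss χ / N))
  have h3 := ((summable_twistedSum_div_sq χ).hasSum.tendsto_sum_nat).const_mul
    (-(if N = 1 then (x : ℂ) / (4 * Real.pi ^ 2) else 0))
  rw [← K_eq_tsum χ hNh] at h2
  rw [← RN_eq_tsum heven] at h3
  refine ((h1.sub h2).sub h3).congr fun M => ?_
  rw [Finset.mul_sum, Finset.mul_sum, Finset.mul_sum, sub_sub, add_comm (∑ m ∈ _, _) (∑ m ∈ _, _),
    sub_right_comm, ← Finset.sum_add_distrib, ← Finset.sum_sub_distrib]
  congr 1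
  refine Finset.sum_congr rfl fun m _ => ?_
  rw [dualTerm_eq, twistedSum_eq_gauss_mul hχ]
  have hm : (m : ℂ) + 1 ≠ 0 := Nat.cast_add_one_ne_zero m
  have hNC : (N : ℂ) ≠ 0 := Nat.cast_ne_zero.mpr (by omega)
  generalize (if N = 1 then (x : ℂ) / (4 * Real.pi ^ 2) else 0) = D
  push_cast
  field_simp
  ring

open Filter Topology in
theorem lambert_identity_of_one_lt {q : ℕ} [NeZero q] (hq : 1 < q) {χ : DirichletCharacter ℂ q}
    (hχ : χ.IsPrimitive) (heven : χ.Even) {N : ℕ} (hN : Odd N) {x : ℝ} (hx : 0 < x) :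
    ∑ r ∈ Finset.Icc 1 q, ∑' n : ℕ, LambertChar.lambertTerm χ N x r (n + 1) =
      LambertChar.R0 χ N x + LambertChar.R1 q N x + LambertChar.RN χ N x
        + LambertChar.K χ N x := by
  have hN1 : 1 ≤ N := hN.pos
  have hNC : (N : ℂ) ≠ 0 := Nat.cast_ne_zero.mpr (by omega)
  obtain ⟨C, hC⟩ := exists_norm_sum_twistedSum_le hq χ
  have h := tendsto_sum_twistedSum_div_sub hχ heven hN hx (c := 0) (C := C)
    (g := fun y => ∑ r ∈ Finset.Icc 1 q, χ (r : ZMod q) *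
      ((Real.exp (-((r : ℝ) / q) * y) / (1 - Real.exp (-y)) : ℝ) : ℂ))
    (fun y hy => (hasSum_twistedSum_mul_poissonTerm hq hχ heven hy).tendsto_sum_nat.congr
      fun M => by simp)
    (fun y hy M => by
      have hb := norm_sum_mul_le_of_antitone hC (f := fun m : ℕ => poissonTerm y ((m : ℝ) + 1))
        (fun m n hmn => poissonTerm_le hy (by positivity) (by gcongr))
        (fun m => poissonTerm_nonneg hy _) M
      have hC0 : 0 ≤ C := (norm_nonneg _).trans (hC 0)
      rw [zero_mul, Complex.ofReal_zero, sub_zero]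
      refine hb.trans (mul_le_mul_of_nonneg_left ?_ hC0)
      rw [← poissonTerm_zero hy]
      exact poissonTerm_le hy le_rfl (by positivity))
  rw [← sum_tsum_lambertTerm χ hN1 hx] at h
  simp only [zero_div, zero_mul, Complex.ofReal_zero, sub_zero] at h
  -- `h` already contains the convergence of ∑ τ(m)/m, so only the value of its limit remains to be
  -- identified.
  have h2 := h.const_mul (2 * (N : ℂ))
  have h3 := eq_of_tendsto_sum_twistedSum_div hq hχ heven (h2.congr fun M => by
    rw [← mul_assoc, mul_one_div_cancel (mul_ne_zero two_ne_zero hNC), one_mul])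
  rw [LambertChar.R0, if_neg hq.ne', LambertChar.R1, if_neg hq.ne']
  rw [neg_mul, ← mul_neg, ← h3]
  field_simp
  ring

open Filter Topology in
/-- The logarithmic divergences of the harmonic sum and of `∑ arctan (T / n ^ N) / n` cancel. -/
theorem tendsto_harmonic_sub_tsum_arctan {N : ℕ} (hN : 1 ≤ N) {x : ℝ} (hx : 0 < x) :
    Tendsto (fun M : ℕ => 1 / (2 * (N : ℝ)) * ∑ m ∈ Finset.range M, 1 / ((m : ℝ) + 1) -
      1 / Real.pi * ∑' n : ℕ, 1 / ((n : ℝ) + 1) *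
        Real.arctan (2 * Real.pi * M / x / ((n : ℝ) + 1) ^ N)) atTop
      (𝓝 (1 / (2 * (N : ℝ)) * (Real.eulerMascheroniConstant * (1 - (N : ℝ))
        - Real.log (2 * Real.pi) + Real.log x))) := by
  have hN' : (0 : ℝ) < N := Nat.cast_pos.mpr hN
  have hpi := Real.pi_pos
  -- Chosen so that e^(NL) = 2πM/x, the argument of the arctangent series.
  set L : ℕ → ℝ := fun M => Real.log (2 * Real.pi * M / x) / N with hL
  have hLlim : Tendsto L atTop atTop := by
    refine Tendsto.atTop_div_const hN' (Real.tendsto_log_atTop.comp ?_)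
    exact (tendsto_natCast_atTop_atTop.const_mul_atTop (by positivity)).atTop_div_const hx
  have h1 := ((tendsto_tsum_arctan_div_pow hN).comp hLlim).const_mul (1 / Real.pi)
  have h2 := Real.tendsto_harmonic_sub_log.const_mul (1 / (2 * (N : ℝ)))
  have h3 := (h2.sub h1).sub_const (1 / (2 * (N : ℝ)) * (Real.log (2 * Real.pi) - Real.log x))
  refine (h3.congr' ?_).trans_eq ?_
  · filter_upwards [eventually_gt_atTop 0] with M hM
    have hM' : (0 : ℝ) < M := Nat.cast_pos.mpr hM
    have hexp : Real.exp (N * L M) = 2 * Real.pi * M / x := by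
      rw [hL]
      simp only
      rw [mul_div_cancel₀ _ hN'.ne', Real.exp_log (by positivity)]
    have hharm : (harmonic M : ℝ) = ∑ m ∈ Finset.range M, 1 / ((m : ℝ) + 1) := by
      simp [harmonic]
    have hlog : Real.log (2 * Real.pi * M / x) =
        Real.log (2 * Real.pi) + Real.log M - Real.log x := by
      rw [Real.log_div (by positivity) hx.ne', Real.log_mul (by positivity) hM'.ne']
    simp only [Function.comp_apply, hexp, hharm]
    simp only [hL, hlog]
    field_simp
    ring
  · congr 1
    field_simp
    ring

theorem hasSum_one_div_succ_pow {N : ℕ} (hN : 1 ≤ N) :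
    HasSum (fun n : ℕ => 1 / ((n : ℂ) + 1) ^ (N + 1)) (riemannZeta ((N : ℂ) + 1)) := by
  have h := zeta_nat_eq_tsum_of_gt_one (show 1 < N + 1 by omega)
  push_cast at h
  have hs : Summable fun n : ℕ => 1 / (n : ℂ) ^ (N + 1) :=
    (Complex.summable_ofReal.mpr (Real.summable_one_div_nat_pow.mpr
      (show 1 < N + 1 by omega))).congr fun n => by push_cast; rfl
  have h2 := (hasSum_nat_add_iff' 1).mpr hs.hasSum
  rw [← h] at h2
  simpa using h2

open Filter Topology in
theorem lambert_identity_of_eq_one {χ : DirichletCharacter ℂ 1}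
    (hχ : χ.IsPrimitive) (heven : χ.Even) {N : ℕ} (hN : Odd N) {x : ℝ} (hx : 0 < x) :
    ∑ r ∈ Finset.Icc 1 1, ∑' n : ℕ, LambertChar.lambertTerm χ N x r (n + 1) =
      LambertChar.R0 χ N x + LambertChar.R1 1 N x + LambertChar.RN χ N x
        + LambertChar.K χ N x := by
  have hN1 : 1 ≤ N := hN.pos
  have hxC : (x : ℂ) ≠ 0 := Complex.ofReal_ne_zero.mpr hx.ne'
  have hχ1 : ∀ j : ZMod 1, χ j = 1 := fun j => by rw [Subsingleton.elim j 1, map_one]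
  have htw : ∀ m, twistedSum χ m = 1 := by
    intro m
    simp [twistedSum, hχ1, Complex.exp_two_pi_mul_I]
  have hsum : ∀ y M, ∑ m ∈ Finset.range M, twistedSum χ (m + 1) *
      (poissonTerm y ((m : ℝ) + 1) : ℂ) - ((1 * poissonPrimitive y M : ℝ) : ℂ) =
      ((∑ m ∈ Finset.range M, poissonTerm y ((m : ℝ) + 1) - poissonPrimitive y M : ℝ) : ℂ) := by
    intro y M
    simp [htw]
  have hprim : ∀ y : ℝ, 0 < y →
      Tendsto (fun M : ℕ => poissonPrimitive y M) atTop (𝓝 (1 / 2)) := by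
    intro y hy
    have h1 : Tendsto (fun M : ℕ => 2 * Real.pi * (M : ℝ) / y) atTop atTop :=
      (tendsto_natCast_atTop_atTop.const_mul_atTop (by positivity)).atTop_div_const hy
    have h2 := (((tendsto_nhds_of_tendsto_nhdsWithin Real.tendsto_arctan_atTop)).comp
      h1).const_mul (1 / Real.pi)
    have e : 1 / Real.pi * (Real.pi / 2) = 1 / 2 := by
      have := Real.pi_ne_zero
      field_simp
    rwa [e] at h2
  have h := tendsto_sum_twistedSum_div_sub hχ heven hN hx (c := 1) (C := 1)
    -- The constant 1/2 of `hasSum_poissonTerm` is cancelled by the limit 1/2 of the subtracted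
    -- primitive.
    (g := fun y => ((Real.exp (-y) / (1 - Real.exp (-y)) - 1 / y : ℝ) : ℂ))
    (fun y hy => by
      simp_rw [hsum]
      have := ((hasSum_poissonTerm hy).tendsto_sum_nat).sub (hprim y hy)
      rw [add_sub_cancel_right] at this
      exact (Complex.continuous_ofReal.tendsto _).comp this)
    (fun y hy M => by
      rw [hsum, Complex.norm_real, Real.norm_eq_abs, one_mul]
      exact abs_sum_poissonTerm_sub_primitive_le hy M)
  have hreal := (Complex.continuous_ofReal.tendsto _).comp (tendsto_harmonic_sub_tsum_arctan hN1 hx)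
  have heq := tendsto_nhds_unique h (hreal.congr fun M => by
    simp only [Function.comp_apply, htw]
    push_cast
    ring)
  have hzeta := (hasSum_one_div_succ_pow hN1).mul_right (1 / (x : ℂ))
  have hlamb : Summable fun n : ℕ => LambertChar.lambertTerm χ N x 1 (n + 1) :=
    summable_lambertTerm χ hN1 hx (by simp)
  have hg : ∑' n : ℕ, 1 / ((n : ℂ) + 1) *
      ((Real.exp (-(((n : ℝ) + 1) ^ N * x)) / (1 - Real.exp (-(((n : ℝ) + 1) ^ N * x))) -
        1 / (((n : ℝ) + 1) ^ N * x) : ℝ) : ℂ) =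
      ∑ r ∈ Finset.Icc 1 1, ∑' n : ℕ, LambertChar.lambertTerm χ N x r (n + 1) -
        riemannZeta ((N : ℂ) + 1) * (1 / x) := by
    rw [Finset.Icc_self, Finset.sum_singleton, ← (hlamb.hasSum.sub hzeta).tsum_eq]
    refine tsum_congr fun n => ?_
    have hn : (n : ℂ) + 1 ≠ 0 := Nat.cast_add_one_ne_zero n
    rw [LambertChar.lambertTerm, hχ1, Nat.cast_one, div_one, neg_mul _ x,
      neg_mul 1 _, one_mul, neg_mul]
    push_cast
    rw [pow_succ]
    field_simp
  rw [hg] at heq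
  rw [LambertChar.R0, if_pos rfl, LambertChar.R1, if_pos rfl, ← heq]
  ring

theorem theorem2p5 (q : ℕ) [NeZero q] (χ : DirichletCharacter ℂ q) (hprim : χ.IsPrimitive)
    (heven : χ.Even) (N : ℕ) (hN : Odd N) (x : ℝ) (hx : 0 < x) :
    (∀ r ∈ Finset.Icc 1 q, Summable fun n : ℕ+ => LambertChar.lambertTerm χ N x r (n : ℕ)) ∧
    (Summable fun n : ℕ+ => LambertChar.dualTerm χ N x (n : ℕ)) ∧
    ∑ r ∈ Finset.Icc 1 q, ∑' n : ℕ+, LambertChar.lambertTerm χ N x r (n : ℕ) =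
      LambertChar.R0 χ N x + LambertChar.R1 q N x + LambertChar.RN χ N x
        + LambertChar.K χ N x := by
  refine ⟨fun r hr => ?_, ?_, ?_⟩
  · exact summable_pnat_iff_summable_succ.mpr (summable_lambertTerm χ hN.pos hx hr)
  · exact summable_pnat_iff_summable_succ.mpr (summable_dualTerm χ hN.pos hx)
  · have hconv : ∀ r, ∑' n : ℕ+, LambertChar.lambertTerm χ N x r (n : ℕ) =
        ∑' n : ℕ, LambertChar.lambertTerm χ N x r (n + 1) := fun r =>
      tsum_pnat_eq_tsum_succ (f := fun n => LambertChar.lambertTerm χ N x r n)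
    simp_rw [hconv]
    rcases Nat.lt_or_ge 1 q with hq | hq
    · exact lambert_identity_of_one_lt hq hprim heven hN hx
    · obtain rfl : q = 1 := le_antisymm hq (Nat.one_le_iff_ne_zero.mpr (NeZero.ne q))
      exact lambert_identity_of_eq_one hprim heven hN hx
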